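/- **Setting.** $K$ single-antenna users (UEs), $L$ access points (APs) with $N$ antennas each, pilot length $\tau$, coherence blocks of $\tau_c\ge\tau$ symbols, transmit powers $p_i\ge 0$, ADC/DAC distortion factors $\rho_{\rm ad},\rho_{\rm da}\in[0,1)$, noise variance $\sigma^2>0$, $\ddot p_i=(1-\rho_{\rm da})p_i$. The channel of UE $i$ to AP $l$ is $\mathbf h_{il}=\bar{\mathbf h}_{il}+\mathbf h_{{\rm w},il}$ with $\mathbf h_{{\rm w},il}\sim\mathcal{CN}(\mathbf 0,\mathbf R_{il})$, $\mathbf R_{il}$ positive semidefinite, and $\bar{\mathbf h}_{il}=\sqrt{\tfrac{\kappa_{il}\beta_{il}}{\kappa_{il}+1}}\,[1,e^{-{\rm j}\pi\sin\theta_{il}},\dots,e^{-{\rm j}(N-1)\pi\sin\theta_{il}}]^{\rm T}$, $\beta_{il},\kappa_{il}\ge0$. UE $i$ uses column $t_i$, denoted $\boldsymbol\phi_{t_i}$, of the $\tau\times\tau$ DFT matrix as pilot; $\mathcal P_k=\{i: t_i=t_k\}$; $\mathcal M_k\neq\emptyset$ is the set of APs serving UE $k$. Let $\mathrm{diag}(\cdot)$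 keep only the diagonal of a matrix, and put $\mathbf G_l=\sum_i\ddot p_i(\bar{\mathbf h}_{il}\bar{\mathbf h}_{il}^{\rm H}+\mathbf R_{il})$, $$\mathbf C_{{\rm n},l}=\tfrac{(1-\rho_{\rm ad})^2\rho_{\rm da}}{1-\rho_{\rm da}}\mathbf G_l+\tfrac{\rho_{\rm ad}(1-\rho_{\rm ad})}{1-\rho_{\rm da}}\mathrm{diag}(\mathbf G_l)+(1-\rho_{\rm ad})\sigma^2\mathbf I_N,\qquad \boldsymbol\Psi_{kl}=(1-\rho_{\rm ad})^2\sum_{i\in\mathcal P_k}\ddot p_i\tau\mathbf R_{il}+\mathbf C_{{\rm n},l}.$$ *Pilot phase.* AP $l$ receives $\mathbf Z_l=(1-\rho_{\rm ad})\sum_i\sqrt{\ddot p_i}\,\mathbf h_{il}\boldsymbol\phi_{t_i}^{\rm T}+\mathbf N_l$, where the effective noise $\mathbf N_l$ (thermal and quantization noise) has independent columns $\sim\mathcal{CN}(\mathbf 0,\mathbf C_{{\rm n},l})$. With $\mathbf z^{\rm w}_{kl}=\mathbf Z_l\boldsymbol\phi_{t_k}^*/\sqrt\tau-(1-\rho_{\rm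 ad})\sum_{i\in\mathcal P_k}\sqrt{\ddot p_i\tau}\,\bar{\mathbf h}_{il}$, the MMSE channel estimate is $\hat{\mathbf h}_{kl}=\bar{\mathbf h}_{kl}+(1-\rho_{\rm ad})\sqrt{\ddot p_k\tau}\,\mathbf R_{kl}\boldsymbol\Psi_{kl}^{-1}\mathbf z^{\rm w}_{kl}$. *Data phase.* The effective noise at AP $l$ is $\mathbf n_l=(1-\rho_{\rm ad})\sum_i\mathbf h_{il}n_{{\rm da},i}+(1-\rho_{\rm ad})\mathbf n_{{\rm an},l}+\mathbf n_{{\rm ad},l}$ with $n_{{\rm da},i}\sim\mathcal{CN}(0,\rho_{\rm da}p_i)$, $\mathbf n_{{\rm an},l}\sim\mathcal{CN}(\mathbf 0,\sigma^2\mathbf I_N)$, $\mathbf n_{{\rm ad},l}\sim\mathcal{CN}(\mathbf 0,\rho_{\rm ad}(1-\rho_{\rm ad})\mathrm{diag}(\mathbb E[\mathbf x_l\mathbf x_l^{\rm H}]))$, where $\mathbf x_l=\sum_i\mathbf h_{il}(\sqrt{1-\rho_{\rm da}}\,s_i+n_{{\rm da},i})+\mathbf n_{{\rm an},l}$ is the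 ADC input and $s_i\sim\mathcal{CN}(0,p_i)$. All of $\mathbf h_{{\rm w},il}$, the columns of $\mathbf N_l$, $s_i$, $n_{{\rm da},i}$, $\mathbf n_{{\rm an},l}$, $\mathbf n_{{\rm ad},l}$ are mutually independent. With MRC ($\mathbf v_{kl}=\hat{\mathbf h}_{kl}$) put $\mathbf g_{ki}=[\hat{\mathbf h}_{kl}^{\rm H}\mathbf h_{il}]_{l\in\mathcal M_k}$ and $\mathbf f_k=[\hat{\mathbf h}_{kl}^{\rm H}\mathbf n_l]_{l\in\mathcal M_k}$. For a large-scale fading decoding (LSFD) vector $\mathbf a\neq\mathbf 0$ the uplink spectral efficiency (SE) of UE $k$ is $$R_k(\mathbf a)=\Big(1-\frac{\tau}{\tau_c}\Big)\log_2\!\left(1+\frac{(1-\rho_{\rm ad})^2\ddot p_k|\mathbf a^{\rm H}\mathbb E[\mathbf g_{kk}]|^2}{(1-\rho_{\rm ad})^2\sum_i\ddot p_i\mathbb E[|\mathbf a^{\rm H}\mathbf g_{ki}|^2]-(1-\rho_{\rm ad})^2\ddot p_k|\mathbf a^{\rm H}\mathbb E[\mathbf g_{kk}]|^2+\mathbf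 a^{\rm H}\mathbb E[\mathbf f_k\mathbf f_k^{\rm H}]\mathbf a}\right).$$ Put $\mathbf B_k=(1-\rho_{\rm ad})^2\sum_i\ddot p_i\mathbb E[\mathbf g_{ki}\mathbf g_{ki}^{\rm H}]+\mathbb E[\mathbf f_k\mathbf f_k^{\rm H}]-(1-\rho_{\rm ad})^2\ddot p_k\mathbb E[\mathbf g_{kk}]\mathbb E[\mathbf g_{kk}]^{\rm H}$. **Theorem.** Let $p_k>0$, and for every $l\in\mathcal M_k$ let $\bar{\mathbf h}_{kl}\ne\mathbf 0$ or $\mathbf R_{kl}\neq\mathbf 0$. Then the entries of $\mathbf g_{ki}$, $\mathbf g_{ki}\mathbf g_{ki}^{\rm H}$ and $\mathbf f_k\mathbf f_k^{\rm H}$ are integrable, $\mathbf B_k$ and the matrix $\mathbf C_k$ below are positive definite, and the maximum of $R_k(\mathbf a)$ over $\mathbf a\ne\mathbf 0$ exists, is attained at the optimal LSFD vector $\mathbf a=\mathbf B_k^{-1}\mathbb E[\mathbf g_{kk}]\ne\mathbf 0$, and equals $$\Big(1-\frac{\tau}{\tau_c}\Big)\log_2\!\big(1+(1-\rho_{\rm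 ad})^2\ddot p_k\,\mathbb E[\mathbf g_{kk}]^{\rm H}\mathbf B_k^{-1}\mathbb E[\mathbf g_{kk}]\big)=\Big(1-\frac{\tau}{\tau_c}\Big)\log_2\!\big(1+(1-\rho_{\rm ad})^2\ddot p_k(\boldsymbol\lambda_k^k+\mathbf b_k^k)^{\rm H}\mathbf C_k^{-1}(\boldsymbol\lambda_k^k+\mathbf b_k^k)\big).$$ Here $\boldsymbol\lambda_k^i=[\lambda_{kl}^i]_{l\in\mathcal M_k}$, $\mathbf b_k^i=[b_{kl}^i]_{l\in\mathcal M_k}$, $\lambda_{kl}^i=\bar{\mathbf h}_{kl}^{\rm H}\bar{\mathbf h}_{il}$, $b_{kl}^i=(1-\rho_{\rm ad})^2\tau\sqrt{\ddot p_k\ddot p_i}\,\mathrm{tr}(\mathbf R_{il}\boldsymbol\Psi_{kl}^{-1}\mathbf R_{kl})$, $$c_{kl}^i=(1-\rho_{\rm ad})^2\tau\ddot p_k\,\mathrm{tr}(\mathbf R_{il}\mathbf R_{kl}\boldsymbol\Psi_{kl}^{-1}\mathbf R_{kl})+\bar{\mathbf h}_{kl}^{\rm H}\mathbf R_{il}\bar{\mathbf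 h}_{kl}+(1-\rho_{\rm ad})^2\tau\ddot p_k\,\bar{\mathbf h}_{il}^{\rm H}\mathbf R_{kl}\boldsymbol\Psi_{kl}^{-1}\mathbf R_{kl}\bar{\mathbf h}_{il},$$ $$\begin{aligned}d_{kl}&=\tfrac{\rho_{\rm ad}(1-\rho_{\rm ad})}{1-\rho_{\rm da}}\bar{\mathbf h}_{kl}^{\rm H}\mathrm{diag}\Big(\sum_i\ddot p_i\mathbf R_{il}\Big)\bar{\mathbf h}_{kl}+\tfrac{\rho_{\rm ad}(1-\rho_{\rm ad})^3}{1-\rho_{\rm da}}\tau\ddot p_k\,\mathrm{tr}\Big(\mathrm{diag}\Big(\sum_i\ddot p_i\mathbf R_{il}\Big)\mathbf R_{kl}\boldsymbol\Psi_{kl}^{-1}\mathbf R_{kl}\Big)\\&\quad+(1-\rho_{\rm ad})\Big[\sigma^2+\tfrac{\rho_{\rm ad}}{1-\rho_{\rm da}}\sum_i\tfrac{\ddot p_i\beta_{il}\kappa_{il}}{\kappa_{il}+1}\Big]\big[\bar{\mathbf h}_{kl}^{\rm H}\bar{\mathbf h}_{kl}+(1-\rho_{\rm ad})^2\tau\ddot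 p_k\,\mathrm{tr}(\mathbf R_{kl}\boldsymbol\Psi_{kl}^{-1}\mathbf R_{kl})\big],\end{aligned}$$ $$\begin{aligned}\mathbf C_k&=\tfrac{(1-\rho_{\rm ad})^2}{1-\rho_{\rm da}}\Big\{\sum_{i=1}^K\ddot p_i\big[\boldsymbol\lambda_k^i(\boldsymbol\lambda_k^i)^{\rm H}+\mathrm{diag}(c_{kl}^i)_{l\in\mathcal M_k}\big]+\sum_{i\in\mathcal P_k}\ddot p_i\big[\mathbf b_k^i(\mathbf b_k^i)^{\rm H}+\mathbf b_k^i(\boldsymbol\lambda_k^i)^{\rm H}+\boldsymbol\lambda_k^i(\mathbf b_k^i)^{\rm H}\big]\Big\}\\&\quad-(1-\rho_{\rm ad})^2\ddot p_k(\boldsymbol\lambda_k^k+\mathbf b_k^k)(\boldsymbol\lambda_k^k+\mathbf b_k^k)^{\rm H}+\mathrm{diag}(d_{kl})_{l\in\mathcal M_k}.\end{aligned}$$ -/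

import Mathlib

open MeasureTheory ProbabilityTheory
open scoped Matrix ComplexConjugate ComplexOrder

noncomputable section

namespace CellFree

/-! ### Circularly symmetric complex Gaussian vectors -/

/-- The scalar law `CN(0, 1)`: independent real and imaginary parts, each `N(0, 1/2)`. -/
def stdComplexGaussian : Measure ℂ :=
  ((gaussianReal 0 (1 / 2)).prod (gaussianReal 0 (1 / 2))).map
    (fun z : ℝ × ℝ => (z.1 : ℂ) + (z.2 : ℂ) * Complex.I)

/-- `X ∼ CN(m, R)`: the law of `X` is the law of `m + A w`, where `w` has i.i.d. `CN(0, 1)`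
entries and `A` is a square root of the covariance, `A Aᴴ = R` (the law of `m + A w` depends on
`A` through `A Aᴴ` only). -/
def IsCN {Ω ι : Type*} [MeasurableSpace Ω] [Fintype ι] (X : Ω → ι → ℂ) (m : ι → ℂ)
    (R : Matrix ι ι ℂ) (P : Measure Ω) : Prop :=
  Measurable X ∧ ∃ A : Matrix ι ι ℂ, A * Aᴴ = R ∧
    P.map X = (Measure.pi fun _ : ι => stdComplexGaussian).map (fun w => m + A *ᵥ w)

/-- The expectation of a random vector, entry by entry. -/
def expVec {Ω ι : Type*} [MeasurableSpace Ω] (P : Measure Ω) (x : Ω → ι → ℂ) : ι → ℂ :=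
  fun a => ∫ ω, x ω a ∂P

/-- The second-moment matrix `E[x xᴴ]`, entry by entry. -/
def expOuter {Ω ι : Type*} [MeasurableSpace Ω] (P : Measure Ω) (x : Ω → ι → ℂ) :
    Matrix ι ι ℂ :=
  Matrix.of fun a b => ∫ ω, x ω a * conj (x ω b) ∂P

/-- `diag(A)`: the matrix `A` with its off-diagonal entries replaced by zero. -/
def diagPart {ι : Type*} [DecidableEq ι] (A : Matrix ι ι ℂ) : Matrix ι ι ℂ :=
  Matrix.diagonal A.diag

/-! ### Deterministic parameters -/

/-- Parameters of a network with `K` single-antenna users, `L` access points with `N` antennas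
each, and pilots of length `τ`. -/
structure Params (K L N τ : ℕ) where
  /-- distortion factor of the ADCs -/
  ρad : ℝ
  /-- distortion factor of the DACs -/
  ρda : ℝ
  /-- the thermal noise has variance `σ ^ 2` -/
  σ : ℝ
  /-- transmit powers -/
  p : Fin K → ℝ
  /-- received powers of the faded signals -/
  β : Fin K → Fin L → ℝ
  /-- Rician factors -/
  κ : Fin K → Fin L → ℝ
  /-- angles of arrival of the LOS paths -/
  θ : Fin K → Fin L → ℝ
  /-- spatial correlation matrices of the NLOS parts -/
  R : Fin K → Fin L → Matrix (Fin N) (Fin N) ℂ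
  /-- pilot index of each user -/
  pilot : Fin K → Fin τ
  /-- cluster of access points serving each user -/
  cluster : Fin K → Finset (Fin L)

namespace Params

variable {K L N τ : ℕ} (S : Params K L N τ)

/-- The ranges of the parameters. -/
structure Valid : Prop where
  ρad_nonneg : 0 ≤ S.ρad
  ρad_lt_one : S.ρad < 1
  ρda_nonneg : 0 ≤ S.ρda
  ρda_lt_one : S.ρda < 1
  σ_pos : 0 < S.σ
  p_nonneg : ∀ i, 0 ≤ S.p i
  β_nonneg : ∀ i l, 0 ≤ S.β i l
  κ_nonneg : ∀ i l, 0 ≤ S.κ i l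
  R_posSemidef : ∀ i l, (S.R i l).PosSemidef

/-- The power `(1 - ρ_da) p_i`. -/
def pdd (i : Fin K) : ℝ := (1 - S.ρda) * S.p i

/-- The large-scale fading coefficient of the LOS path. -/
def βLOS (i : Fin K) (l : Fin L) : ℝ := S.κ i l * S.β i l / (S.κ i l + 1)

/-- The LOS vector (half-wavelength uniform linear array). -/
def hbar (i : Fin K) (l : Fin L) : Fin N → ℂ := fun n =>
  (Real.sqrt (S.βLOS i l) : ℂ) *
    Complex.exp (-(Complex.I * (n : ℕ) * (Real.pi : ℂ) * (Real.sin (S.θ i l) : ℂ)))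

/-- The users that share the pilot of user `k` (including `k`). -/
def sharing (k : Fin K) : Finset (Fin K) :=
  Finset.univ.filter fun i => S.pilot i = S.pilot k

/-- `H̄_l P̈ H̄_lᴴ + ∑_i p̈_i R_il`. -/
def gram (l : Fin L) : Matrix (Fin N) (Fin N) ℂ :=
  ∑ i, (S.pdd i : ℂ) • (Matrix.vecMulVec (S.hbar i l) (star (S.hbar i l)) + S.R i l)

/-- The covariance matrix `C_{n,l}` of the effective noise at access point `l`. -/
def Cn (l : Fin L) : Matrix (Fin N) (Fin N) ℂ :=
  (((1 - S.ρad) ^ 2 * S.ρda / (1 - S.ρda) : ℝ) : ℂ) • S.gram l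
    + ((S.ρad * (1 - S.ρad) / (1 - S.ρda) : ℝ) : ℂ) • diagPart (S.gram l)
    + (((1 - S.ρad) * S.σ ^ 2 : ℝ) : ℂ) • (1 : Matrix (Fin N) (Fin N) ℂ)

/-- The matrix `Ψ` belonging to the pilot of user `k` at access point `l`. -/
def Ψ (k : Fin K) (l : Fin L) : Matrix (Fin N) (Fin N) ℂ :=
  (((1 - S.ρad) ^ 2 : ℝ) : ℂ) • ∑ i ∈ S.sharing k, ((S.pdd i * τ : ℝ) : ℂ) • S.R i l + S.Cn l

/-- The pilot sequences: the columns of the `τ × τ` DFT matrix. -/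
def _root_.CellFree.dftPilot (τ : ℕ) (t : Fin τ) : Fin τ → ℂ := fun u =>
  Complex.exp (-(Complex.I * 2 * (Real.pi : ℂ) * (t : ℕ) * (u : ℕ) / (τ : ℂ)))

/-! ### The closed-form quantities -/

/-- `λ_{kl}^i`. -/
def lam (k i : Fin K) (l : Fin L) : ℂ := star (S.hbar k l) ⬝ᵥ S.hbar i l

/-- `b_{kl}^i`. -/
def b (k i : Fin K) (l : Fin L) : ℂ :=
  (((1 - S.ρad) ^ 2 * τ * Real.sqrt (S.pdd k * S.pdd i) : ℝ) : ℂ) *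
    (S.R i l * (S.Ψ k l)⁻¹ * S.R k l).trace

/-- `c_{kl}^i`. -/
def c (k i : Fin K) (l : Fin L) : ℂ :=
  (((1 - S.ρad) ^ 2 * τ * S.pdd k : ℝ) : ℂ) *
      (S.R i l * S.R k l * (S.Ψ k l)⁻¹ * S.R k l).trace
    + star (S.hbar k l) ⬝ᵥ (S.R i l *ᵥ S.hbar k l)
    + (((1 - S.ρad) ^ 2 * τ * S.pdd k : ℝ) : ℂ) *
      (star (S.hbar i l) ⬝ᵥ ((S.R k l * (S.Ψ k l)⁻¹ * S.R k l) *ᵥ S.hbar i l))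

/-- `d_{kl}`. -/
def d (k : Fin K) (l : Fin L) : ℂ :=
  ((S.ρad * (1 - S.ρad) / (1 - S.ρda) : ℝ) : ℂ) *
      (star (S.hbar k l) ⬝ᵥ (diagPart (∑ i, (S.pdd i : ℂ) • S.R i l) *ᵥ S.hbar k l))
    + ((S.ρad * (1 - S.ρad) ^ 3 / (1 - S.ρda) * τ * S.pdd k : ℝ) : ℂ) *
      (diagPart (∑ i, (S.pdd i : ℂ) • S.R i l) * S.R k l * (S.Ψ k l)⁻¹ * S.R k l).trace
    + (((1 - S.ρad) * (S.σ ^ 2 + S.ρad / (1 - S.ρda) *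
          ∑ i, S.pdd i * S.β i l * S.κ i l / (S.κ i l + 1)) : ℝ) : ℂ) *
      (star (S.hbar k l) ⬝ᵥ S.hbar k l
        + (((1 - S.ρad) ^ 2 * τ * S.pdd k : ℝ) : ℂ) *
          (S.R k l * (S.Ψ k l)⁻¹ * S.R k l).trace)

/-- The vector `λ_k^i`, indexed by the cluster of user `k`. -/
def lamVec (k i : Fin K) : S.cluster k → ℂ := fun l => S.lam k i l

/-- The vector `b_k^i`, indexed by the cluster of user `k`. -/
def bVec (k i : Fin K) : S.cluster k → ℂ := fun l => S.b k i l

/-- The matrix `C_k`. -/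
def C (k : Fin K) : Matrix (S.cluster k) (S.cluster k) ℂ :=
  (((1 - S.ρad) ^ 2 / (1 - S.ρda) : ℝ) : ℂ) •
      (∑ i, (S.pdd i : ℂ) •
          (Matrix.vecMulVec (S.lamVec k i) (star (S.lamVec k i))
            + Matrix.diagonal fun l : S.cluster k => S.c k i l)
        + ∑ i ∈ S.sharing k, (S.pdd i : ℂ) •
          (Matrix.vecMulVec (S.bVec k i) (star (S.bVec k i))
            + Matrix.vecMulVec (S.bVec k i) (star (S.lamVec k i))
            + Matrix.vecMulVec (S.lamVec k i) (star (S.bVec k i))))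
    - (((1 - S.ρad) ^ 2 * S.pdd k : ℝ) : ℂ) •
        Matrix.vecMulVec (S.lamVec k k + S.bVec k k) (star (S.lamVec k k + S.bVec k k))
    + Matrix.diagonal fun l : S.cluster k => S.d k l

/-- The closed-form spectral efficiency of user `k`, for coherence blocks of `τc` symbols. -/
def closedFormSE (τc : ℕ) (k : Fin K) : ℝ :=
  (1 - (τ : ℝ) / τc) * Real.logb 2 (1 + (1 - S.ρad) ^ 2 * S.pdd k *
    (star (S.lamVec k k + S.bVec k k) ⬝ᵥ ((S.C k)⁻¹ *ᵥ (S.lamVec k k + S.bVec k k))).re)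

end Params

/-! ### Random quantities -/

/-- The elementary random quantities. -/
structure Sources (K L N τ : ℕ) (Ω : Type*) where
  /-- NLOS channels -/
  hw : Fin K → Fin L → Ω → Fin N → ℂ
  /-- columns of the effective noise matrix in the pilot phase -/
  npilot : Fin L → Fin τ → Ω → Fin N → ℂ
  /-- data symbols -/
  s : Fin K → Ω → ℂ
  /-- DAC quantization noise in the data phase -/
  nda : Fin K → Ω → ℂ
  /-- thermal noise in the data phase -/
  nan : Fin L → Ω → Fin N → ℂ
  /-- ADC quantization noise in the data phase -/
  nad : Fin L → Ω → Fin N → ℂ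

/-- Labels of the elementary random quantities. -/
inductive Label (K L τ : ℕ) : Type
  | channel (i : Fin K) (l : Fin L)
  | pilotNoise (l : Fin L) (t : Fin τ)
  | signal (i : Fin K)
  | dac (i : Fin K)
  | thermal (l : Fin L)
  | adc (l : Fin L)

/-- Dimensions of the elementary random quantities. -/
def Label.dim {K L τ : ℕ} (N : ℕ) : Label K L τ → ℕ
  | .channel _ _ => N
  | .pilotNoise _ _ => N
  | .signal _ => 1
  | .dac _ => 1
  | .thermal _ => N
  | .adc _ => N

namespace Sources

variable {K L N τ : ℕ} {Ω : Type*} (X : Sources K L N τ Ω) (S : Params K L N τ)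

/-- All elementary random quantities as one family of random vectors (scalars are vectors of
length one). -/
def family : (j : Label K L τ) → Ω → Fin (j.dim N) → ℂ
  | .channel i l => X.hw i l
  | .pilotNoise l t => X.npilot l t
  | .signal i => fun ω _ => X.s i ω
  | .dac i => fun ω _ => X.nda i ω
  | .thermal l => X.nan l
  | .adc l => X.nad l

/-- The Rician channel `h_il`. -/
def h (i : Fin K) (l : Fin L) (ω : Ω) : Fin N → ℂ := S.hbar i l + X.hw i l ω

/-- The input of the ADCs of access point `l` in the data phase. -/
def adcInput (l : Fin L) (ω : Ω) : Fin N → ℂ :=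
  ∑ i, ((Real.sqrt (1 - S.ρda) : ℂ) * X.s i ω + X.nda i ω) • X.h S i l ω + X.nan l ω

/-- The probabilistic model. All elementary quantities are independent centred circularly
symmetric Gaussians; the ADC quantization noise has the covariance
`ρ_ad (1 - ρ_ad) diag(E[x xᴴ])`, with `x` the ADC input. -/
structure IsModel [MeasurableSpace Ω] (P : Measure Ω) : Prop where
  indep : iIndepFun X.family P
  hw_law : ∀ i l, IsCN (X.hw i l) 0 (S.R i l) P
  npilot_law : ∀ l t, IsCN (X.npilot l t) 0 (S.Cn l) P
  s_law : ∀ i, IsCN (fun ω (_ : Fin 1) => X.s i ω) 0 (Matrix.of fun _ _ => (S.p i : ℂ)) P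
  nda_law : ∀ i, IsCN (fun ω (_ : Fin 1) => X.nda i ω) 0
    (Matrix.of fun _ _ => ((S.ρda * S.p i : ℝ) : ℂ)) P
  nan_law : ∀ l, IsCN (X.nan l) 0 (((S.σ ^ 2 : ℝ) : ℂ) • (1 : Matrix (Fin N) (Fin N) ℂ)) P
  nad_law : ∀ l, IsCN (X.nad l) 0
    (((S.ρad * (1 - S.ρad) : ℝ) : ℂ) • diagPart (expOuter P (X.adcInput S l))) P

/-- The quantized received pilot matrix `Z_l`. -/
def Z (l : Fin L) (ω : Ω) : Matrix (Fin N) (Fin τ) ℂ :=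
  ((1 - S.ρad : ℝ) : ℂ) • ∑ i, (Real.sqrt (S.pdd i) : ℂ) •
      Matrix.vecMulVec (X.h S i l ω) (dftPilot τ (S.pilot i))
    + Matrix.of fun n t => X.npilot l t ω n

/-- The received pilot matrix correlated with the pilot of user `k`. -/
def z (k : Fin K) (l : Fin L) (ω : Ω) : Fin N → ℂ :=
  ((1 / Real.sqrt τ : ℝ) : ℂ) • (X.Z S l ω *ᵥ star (dftPilot τ (S.pilot k)))

/-- `z` without its LOS part. -/
def zw (k : Fin K) (l : Fin L) (ω : Ω) : Fin N → ℂ :=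
  X.z S k l ω - ((1 - S.ρad : ℝ) : ℂ) •
    ∑ i ∈ S.sharing k, (Real.sqrt (S.pdd i * τ) : ℂ) • S.hbar i l

/-- The MMSE channel estimate. -/
def hhat (k : Fin K) (l : Fin L) (ω : Ω) : Fin N → ℂ :=
  S.hbar k l + (((1 - S.ρad) * Real.sqrt (S.pdd k * τ) : ℝ) : ℂ) •
    ((S.R k l * (S.Ψ k l)⁻¹) *ᵥ X.zw S k l ω)

/-- The effective noise in the data phase. -/
def n (l : Fin L) (ω : Ω) : Fin N → ℂ :=
  ((1 - S.ρad : ℝ) : ℂ) • ∑ i, X.nda i ω • X.h S i l ω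
    + ((1 - S.ρad : ℝ) : ℂ) • X.nan l ω + X.nad l ω

/-- The vector `g_ki` for the combining vectors `v`. -/
def g (v : Fin K → Fin L → Ω → Fin N → ℂ) (k i : Fin K) (ω : Ω) : S.cluster k → ℂ :=
  fun l => star (v k l ω) ⬝ᵥ X.h S i l ω

/-- The vector `f_k` for the combining vectors `v`. -/
def f (v : Fin K → Fin L → Ω → Fin N → ℂ) (k : Fin K) (ω : Ω) : S.cluster k → ℂ :=
  fun l => star (v k l ω) ⬝ᵥ X.n S l ω

variable [MeasurableSpace Ω] (P : Measure Ω)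

/-- The SINR of user `k` for the combining vectors `v` and the LSFD vector `a`. -/
def SINR (v : Fin K → Fin L → Ω → Fin N → ℂ) (k : Fin K) (a : S.cluster k → ℂ) : ℝ :=
  (1 - S.ρad) ^ 2 * S.pdd k * ‖star a ⬝ᵥ expVec P (X.g S v k k)‖ ^ 2 /
    ((1 - S.ρad) ^ 2 * ∑ i, S.pdd i * ∫ ω, ‖star a ⬝ᵥ X.g S v k i ω‖ ^ 2 ∂P
      - (1 - S.ρad) ^ 2 * S.pdd k * ‖star a ⬝ᵥ expVec P (X.g S v k k)‖ ^ 2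
      + (star a ⬝ᵥ (expOuter P (X.f S v k) *ᵥ a)).re)

/-- The uplink spectral efficiency of user `k` in the distributed scheme. -/
def SE (τc : ℕ) (v : Fin K → Fin L → Ω → Fin N → ℂ) (k : Fin K) (a : S.cluster k → ℂ) : ℝ :=
  (1 - (τ : ℝ) / τc) * Real.logb 2 (1 + X.SINR S P v k a)

/-- The matrix `B_k` in the generalized Rayleigh quotient. -/
def B (v : Fin K → Fin L → Ω → Fin N → ℂ) (k : Fin K) :
    Matrix (S.cluster k) (S.cluster k) ℂ :=
  (((1 - S.ρad) ^ 2 : ℝ) : ℂ) • ∑ i, (S.pdd i : ℂ) • expOuter P (X.g S v k i)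
    + expOuter P (X.f S v k)
    - (((1 - S.ρad) ^ 2 * S.pdd k : ℝ) : ℂ) •
      Matrix.vecMulVec (expVec P (X.g S v k k)) (star (expVec P (X.g S v k k)))

/-- The optimal LSFD vector. -/
def aopt (v : Fin K → Fin L → Ω → Fin N → ℂ) (k : Fin K) : S.cluster k → ℂ :=
  (X.B S P v k)⁻¹ *ᵥ expVec P (X.g S v k k)

/-- The spectral efficiency written through the inverse of `B_k`. -/
def SEmax (τc : ℕ) (v : Fin K → Fin L → Ω → Fin N → ℂ) (k : Fin K) : ℝ :=
  (1 - (τ : ℝ) / τc) * Real.logb 2 (1 + (1 - S.ρad) ^ 2 * S.pdd k *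
    (star (expVec P (X.g S v k k)) ⬝ᵥ
      ((X.B S P v k)⁻¹ *ᵥ expVec P (X.g S v k k))).re)

end Sources

end CellFree

end

/-!
Under MRC the channels and their estimates are affine in the jointly Gaussian NLOS channels and
pilot noise, so the entries of `E[g gᴴ]` are fourth moments of noncentred circular Gaussian
variables, given by Isserlis' formula. Distinct access points are independent, and therefore
`E[g_ki g_kiᴴ] = ḡ_ki ḡ_kiᴴ + diag(c_kl^i)` with `ḡ_ki = λ_k^i + 1{i ∈ P_k} b_k^i`. The entries of
`f_k` are linear combinations of the data-phase Gaussians with weights determined by the channel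
phase, which is independent of them. In the second moment only the squares survive: the DAC noise
of user `i` contributes a multiple of `E[g_ki g_kiᴴ]`, thermal and ADC noise the diagonal matrix of
the `d_kl`. Hence `B_k = C_k`, and this matrix is positive definite because it is a sum of positive
semidefinite matrices and `diag(d_kl)`, where `d_kl > 0`. The SINR is a generalized Rayleigh
quotient of `B_k` and `E[g_kk]`, which the Cauchy–Schwarz inequality for the inner product
`xᴴ B_k y` maximizes.
-/

noncomputable section

namespace CellFree

/-! ### Expectations -/

/-- `f` is integrable with expectation `v`: the equation `∫ f = v` alone would also hold for
non-integrable `f` when `v = 0`. -/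
def HasExp {Ω : Type*} [MeasurableSpace Ω] (P : Measure Ω) (f : Ω → ℂ) (v : ℂ) : Prop :=
  Integrable f P ∧ ∫ ω, f ω ∂P = v

namespace HasExp

variable {Ω : Type*} [MeasurableSpace Ω] {P : Measure Ω} {f g : Ω → ℂ} {u v : ℂ}

theorem congr (hf : HasExp P f u) (h : ∀ ω, g ω = f ω) (h' : v = u) : HasExp P g v := by
  rw [h', funext h]; exact hf

theorem const [IsProbabilityMeasure P] (c : ℂ) : HasExp P (fun _ => c) c :=
  ⟨integrable_const c, by simp⟩

theorem add (hf : HasExp P f u) (hg : HasExp P g v) : HasExp P (fun ω => f ω + g ω) (u + v) :=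
  ⟨hf.1.add hg.1, by rw [integral_add hf.1 hg.1, hf.2, hg.2]⟩

theorem const_mul (c : ℂ) (hf : HasExp P f u) : HasExp P (fun ω => c * f ω) (c * u) :=
  ⟨hf.1.const_mul c, by rw [integral_const_mul, hf.2]⟩

theorem sum {ι : Type*} {s : Finset ι} {f : ι → Ω → ℂ} {u : ι → ℂ}
    (h : ∀ i ∈ s, HasExp P (f i) (u i)) : HasExp P (fun ω => ∑ i ∈ s, f i ω) (∑ i ∈ s, u i) :=
  ⟨integrable_finsetSum _ fun i hi => (h i hi).1, by
    rw [integral_finsetSum _ fun i hi => (h i hi).1]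
    exact Finset.sum_congr rfl fun i hi => (h i hi).2⟩

theorem star (hf : HasExp P f u) : HasExp P (fun ω => conj (f ω)) (conj u) :=
  ⟨Complex.conjCLE.toContinuousLinearMap.integrable_comp hf.1, by rw [integral_conj, hf.2]⟩

theorem memLp_two (hm : Measurable f) (hf : HasExp P (fun ω => f ω * conj (f ω)) u) :
    MemLp f 2 P :=
  (memLp_two_iff_integrable_sq_norm hm.aestronglyMeasurable).2 (hf.1.norm.congr
    (.of_forall fun ω => by simp [sq]))

theorem mul_of_indepFun (h : IndepFun f g P) (hf : HasExp P f u) (hg : HasExp P g v) :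
    HasExp P (fun ω => f ω * g ω) (u * v) :=
  ⟨h.integrable_mul hf.1 hg.1, by
    rw [← hf.2, ← hg.2]
    exact h.integral_mul_eq_mul_integral hf.1.aestronglyMeasurable hg.1.aestronglyMeasurable⟩

theorem comp_iff {Ω' : Type*} [MeasurableSpace Ω'] {μ : Measure Ω'} {T : Ω' → Ω}
    (hT : MeasurePreserving T μ P) (hf : Measurable f) :
    HasExp μ (fun ω => f (T ω)) v ↔ HasExp P f v := by
  unfold HasExp
  rw [← hT.map_eq, integrable_map_measure hf.aestronglyMeasurable hT.measurable.aemeasurable,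
    integral_map hT.measurable.aemeasurable hf.aestronglyMeasurable]
  rfl

theorem zero_of_comp_eq_mul {T : Ω → Ω} (hT : MeasurePreserving T P P) (hf : Measurable f)
    (hi : Integrable f P) {c : ℂ} (hc : c ≠ 1) (h : ∀ ω, f (T ω) = c * f ω) : HasExp P f 0 := by
  refine ⟨hi, ?_⟩
  have hint : c * ∫ ω, f ω ∂P = ∫ ω, f ω ∂P := by
    simpa only [h, integral_const_mul] using ((comp_iff hT hf).2 ⟨hi, rfl⟩).2
  have hzero : (c - 1) * ∫ ω, f ω ∂P = 0 := by linear_combination hint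
  exact (mul_eq_zero.1 hzero).resolve_left (sub_ne_zero.2 hc)

end HasExp

/-! ### Gaussian moments -/

section RealGaussian

open scoped NNReal

variable (v : ℝ≥0)

theorem measurePreserving_neg_gaussianReal :
    MeasurePreserving (fun x : ℝ => -x) (gaussianReal 0 v) (gaussianReal 0 v) :=
  ⟨by fun_prop, by simp [gaussianReal_map_neg]⟩

theorem memLp_gaussianReal (p : ℕ) : MemLp (fun x : ℝ => x) p (gaussianReal 0 v) := by
  exact_mod_cast memLp_id_gaussianReal (μ := 0) (v := v) (p : ℝ≥0)

theorem integrable_pow_gaussianReal (p : ℕ) :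
    Integrable (fun x : ℝ => x ^ p) (gaussianReal 0 v) := by
  rcases eq_or_ne p 0 with rfl | hp
  · simp
  · exact ((memLp_gaussianReal v p).integrable_norm_pow hp).mono (by fun_prop) (by simp)

theorem integral_sq_gaussianReal : ∫ x, x ^ 2 ∂gaussianReal 0 v = v := by
  simpa [variance_eq_integral measurable_id'.aemeasurable] using
    variance_fun_id_gaussianReal (μ := 0) (v := v)

theorem integral_odd_pow_gaussianReal {p : ℕ} (hp : Odd p) :
    ∫ x, x ^ p ∂gaussianReal 0 v = 0 := by
  have h := (measurePreserving_neg_gaussianReal v).integral_comp' (f := MeasurableEquiv.neg ℝ)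
    (fun x : ℝ => x ^ p)
  simp only [MeasurableEquiv.neg_apply, hp.neg_pow, integral_neg] at h
  linarith

theorem map_add_prod_gaussianReal :
    ((gaussianReal 0 v).prod (gaussianReal 0 v)).map (fun z : ℝ × ℝ => z.1 + z.2)
      = (gaussianReal 0 v).map (fun x => √2 * x) := by
  have hconv := gaussianReal_conv_gaussianReal (m₁ := 0) (m₂ := 0) (v₁ := v) (v₂ := v)
  rw [Measure.conv] at hconv
  rw [hconv, gaussianReal_map_const_mul]
  congr 1
  · simp
  · ext; simp [two_mul]

/-- For independent `x`, `y` with this law, `x + y` has the law of `√2 x`. Comparing fourth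
moments gives `2 m₄ + 6 v² = 4 m₄`. -/
theorem integral_pow_four_gaussianReal : ∫ x, x ^ 4 ∂gaussianReal 0 v = 3 * v ^ 2 := by
  set γ := gaussianReal 0 v
  have hsum : ∫ z : ℝ × ℝ, (z.1 + z.2) ^ 4 ∂γ.prod γ = 4 * ∫ x, x ^ 4 ∂γ := by
    have h : ∫ x, x ^ 4 ∂(γ.prod γ).map (fun z : ℝ × ℝ => z.1 + z.2)
        = ∫ x, x ^ 4 ∂γ.map (fun x => √2 * x) := by rw [map_add_prod_gaussianReal v]
    have hsqrt : √2 ^ 4 = 4 := by rw [pow_mul √2 2 2, Real.sq_sqrt zero_le_two]; norm_num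
    rwa [integral_map (by fun_prop) (by fun_prop), integral_map (by fun_prop) (by fun_prop),
      funext fun x => mul_pow √2 x 4, integral_const_mul, hsqrt] at h
  have hbinom : ∫ z : ℝ × ℝ, (z.1 + z.2) ^ 4 ∂γ.prod γ = ∑ m ∈ Finset.range 5,
      ((∫ x, x ^ m ∂γ) * ∫ x, x ^ (4 - m) ∂γ) * (Nat.choose 4 m : ℝ) := by
    simp_rw [add_pow]
    rw [integral_finsetSum _ fun m _ => ((integrable_pow_gaussianReal v _).mul_prod
      (integrable_pow_gaussianReal v _)).mul_const _]
    refine Finset.sum_congr rfl fun m _ => ?_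
    rw [integral_mul_const, integral_prod_mul (fun x : ℝ => x ^ m) (fun x : ℝ => x ^ (4 - m))]
  rw [hsum] at hbinom
  simp only [Finset.sum_range_succ, Finset.range_zero, Finset.sum_empty] at hbinom
  norm_num [γ, Nat.choose, integral_odd_pow_gaussianReal v (p := 3) (by decide),
    integral_odd_pow_gaussianReal v (p := 1) (by decide), integral_sq_gaussianReal] at hbinom
  linarith

end RealGaussian

instance : IsProbabilityMeasure stdComplexGaussian := by
  unfold stdComplexGaussian
  exact Measure.isProbabilityMeasure_map (by fun_prop)

theorem memLp_stdComplexGaussian (p : ℕ) : MemLp (fun z : ℂ => z) p stdComplexGaussian := by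
  unfold stdComplexGaussian
  rw [memLp_map_measure_iff (by fun_prop) (by fun_prop)]
  have hofReal := (memLp_gaussianReal (1 / 2) p).ofReal (K := ℂ)
  exact (hofReal.comp_fst _).add ((hofReal.comp_snd _).mul_const Complex.I)

theorem measurePreserving_I_mul_stdComplexGaussian :
    MeasurePreserving (fun z : ℂ => Complex.I * z) stdComplexGaussian stdComplexGaussian := by
  refine ⟨by fun_prop, ?_⟩
  have hrot := ((measurePreserving_neg_gaussianReal (1 / 2)).prod
    (MeasurePreserving.id (gaussianReal 0 (1 / 2)))).comp
    (Measure.measurePreserving_swap (μ := gaussianReal 0 (1 / 2)) (ν := gaussianReal 0 (1 / 2)))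
  unfold stdComplexGaussian
  rw [Measure.map_map (by fun_prop) (by fun_prop)]
  conv_rhs => rw [← hrot.map_eq, Measure.map_map (by fun_prop) hrot.measurable]
  congr 1
  ext z
  simp only [Function.comp, Prod.swap, Prod.map, id, Complex.ofReal_neg]
  linear_combination (z.2 : ℂ) * Complex.I_mul_I

theorem hasExp_stdComplexGaussian_of_prod {F : ℂ → ℂ} (hF : Measurable F) {ψ : ℝ × ℝ → ℝ} {x : ℝ}
    (hψ : Integrable ψ ((gaussianReal 0 (1 / 2)).prod (gaussianReal 0 (1 / 2))))
    (hx : ∫ z, ψ z ∂(gaussianReal 0 (1 / 2)).prod (gaussianReal 0 (1 / 2)) = x)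
    (h : ∀ z : ℝ × ℝ, F ((z.1 : ℂ) + (z.2 : ℂ) * Complex.I) = ψ z) :
    HasExp stdComplexGaussian F x := by
  refine (HasExp.comp_iff ⟨by fun_prop, rfl⟩ hF).1 ?_
  simp only [h]
  exact ⟨hψ.ofReal, by rw [← hx]; exact integral_ofReal⟩

theorem hasExp_mul_conj_stdComplexGaussian :
    HasExp stdComplexGaussian (fun z => z * conj z) 1 := by
  have hfst := (integrable_pow_gaussianReal (1 / 2) 2).comp_fst (gaussianReal 0 (1 / 2))
  have hsnd := (integrable_pow_gaussianReal (1 / 2) 2).comp_snd (gaussianReal 0 (1 / 2))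
  rw [← Complex.ofReal_one]
  refine hasExp_stdComplexGaussian_of_prod (by fun_prop) (hfst.add hsnd) ?_ fun z => ?_
  · rw [integral_add' hfst hsnd, integral_fun_fst (fun x : ℝ => x ^ 2),
      integral_fun_snd (fun x : ℝ => x ^ 2), integral_sq_gaussianReal]
    norm_num
  · rw [Complex.mul_conj]
    simp only [Complex.normSq_add_mul_I, Pi.add_apply]

theorem hasExp_mul_conj_sq_stdComplexGaussian :
    HasExp stdComplexGaussian (fun z => z * conj z * (z * conj z)) 2 := by
  have hfst := (integrable_pow_gaussianReal (1 / 2) 4).comp_fst (gaussianReal 0 (1 / 2))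
  have hsnd := (integrable_pow_gaussianReal (1 / 2) 4).comp_snd (gaussianReal 0 (1 / 2))
  have hmix := ((integrable_pow_gaussianReal (1 / 2) 2).mul_prod
    (integrable_pow_gaussianReal (1 / 2) 2)).const_mul 2
  rw [← Complex.ofReal_ofNat]
  refine hasExp_stdComplexGaussian_of_prod (by fun_prop) (hfst.add (hmix.add hsnd)) ?_ fun z => ?_
  · rw [integral_add' hfst (hmix.add hsnd), integral_add' hmix hsnd,
      integral_fun_fst (fun x : ℝ => x ^ 4), integral_fun_snd (fun x : ℝ => x ^ 4),
      integral_pow_four_gaussianReal, integral_const_mul,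
      integral_prod_mul (fun x : ℝ => x ^ 2) (fun x : ℝ => x ^ 2), integral_sq_gaussianReal]
    norm_num
  · rw [Complex.mul_conj]
    simp only [Complex.normSq_add_mul_I, Pi.add_apply]
    push_cast
    ring

section StdVec

variable {V : Type*} [Fintype V]

/-- The law of a vector with independent `CN(0, 1)` entries, as it occurs in `IsCN`. -/
abbrev stdVec (V : Type*) [Fintype V] : Measure (V → ℂ) :=
  Measure.pi fun _ : V => stdComplexGaussian

theorem integrable_mul_mul_mul {Ω : Type*} [MeasurableSpace Ω] {P : Measure Ω} {a b c d : Ω → ℂ}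
    (ha : MemLp a (4 : ℕ) P) (hb : MemLp b (4 : ℕ) P) (hc : MemLp c (4 : ℕ) P)
    (hd : MemLp d (4 : ℕ) P) : Integrable (fun ω => a ω * b ω * c ω * d ω) P := by
  have hbound := (((ha.integrable_norm_pow four_ne_zero).add
    (hb.integrable_norm_pow four_ne_zero)).add (hc.integrable_norm_pow four_ne_zero)).add
    (hd.integrable_norm_pow four_ne_zero)
  refine hbound.mono' (((ha.1.mul hb.1).mul hc.1).mul hd.1) (.of_forall fun ω => ?_)
  simp only [norm_mul, Pi.add_apply]
  nlinarith [sq_nonneg (‖a ω‖ * ‖b ω‖ - ‖c ω‖ * ‖d ω‖), sq_nonneg (‖a ω‖ ^ 2 - ‖b ω‖ ^ 2),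
    sq_nonneg (‖c ω‖ ^ 2 - ‖d ω‖ ^ 2), sq_nonneg (‖a ω‖ ^ 2 + ‖b ω‖ ^ 2),
    sq_nonneg (‖c ω‖ ^ 2 + ‖d ω‖ ^ 2), sq_nonneg (‖a ω‖ ^ 2), sq_nonneg (‖b ω‖ ^ 2)]

theorem memLp_stdVec (v : V) (p : ℕ) : MemLp (fun w : V → ℂ => w v) p (stdVec V) :=
  (memLp_stdComplexGaussian p).comp_measurePreserving (measurePreserving_eval _ v)

theorem integrable_stdVec_four (j k l m : V) :
    Integrable (fun w : V → ℂ => w j * conj (w k) * w l * conj (w m)) (stdVec V) :=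
  integrable_mul_mul_mul (memLp_stdVec j 4) (memLp_stdVec k 4).star (memLp_stdVec l 4)
    (memLp_stdVec m 4).star

theorem measurePreserving_quarter_turn (p : V → Prop) [DecidablePred p] :
    MeasurePreserving (fun (w : V → ℂ) v => (if p v then Complex.I else 1) * w v)
      (stdVec V) (stdVec V) := by
  refine measurePreserving_pi _ _ (f := fun v z => (if p v then Complex.I else 1) * z) fun v => ?_
  by_cases h : p v
  · simpa only [h, if_true] using measurePreserving_I_mul_stdComplexGaussian
  · simpa only [h, if_false, one_mul] using! MeasurePreserving.id stdComplexGaussian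

theorem hasExp_stdVec_eq_zero [DecidableEq V] {F : (V → ℂ) → ℂ} (hF : Measurable F)
    (hi : Integrable F (stdVec V)) (v : V) {c : ℂ} (hc : c ≠ 1)
    (h : ∀ w, F (fun u => (if u = v then Complex.I else 1) * w u) = c * F w) :
    HasExp (stdVec V) F 0 :=
  .zero_of_comp_eq_mul (measurePreserving_quarter_turn (· = v)) hF hi hc h

theorem I_ne_one : Complex.I ≠ 1 := by simp [Complex.ext_iff]

theorem hasExp_stdVec_mul_conj_self (j : V) :
    HasExp (stdVec V) (fun w => w j * conj (w j)) 1 :=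
  (HasExp.comp_iff (measurePreserving_eval (fun _ : V => stdComplexGaussian) j)
    (f := fun z => z * conj z) (by fun_prop)).2 hasExp_mul_conj_stdComplexGaussian

theorem hasExp_stdVec_four_eq_zero {j k l m : V} (hl : l ≠ k ∧ l ≠ m) :
    HasExp (stdVec V) (fun w => w j * conj (w k) * w l * conj (w m)) 0 := by
  classical
  refine hasExp_stdVec_eq_zero (by fun_prop) (integrable_stdVec_four j k l m) l
    (c := (if j = l then Complex.I else 1) * Complex.I) ?_ fun w => ?_
  · split_ifs
    · norm_num
    · simpa using I_ne_one
  · simp only [hl.1.symm, hl.2.symm, if_true, if_false, one_mul]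
    ring

variable [DecidableEq V]

theorem hasExp_stdVec_two (j k : V) :
    HasExp (stdVec V) (fun w => w j * conj (w k)) (if j = k then 1 else 0) := by
  rcases eq_or_ne j k with rfl | h
  · simpa using hasExp_stdVec_mul_conj_self j
  · rw [if_neg h]
    refine hasExp_stdVec_eq_zero (by fun_prop) ?_ j I_ne_one fun w => ?_
    · simpa using integrable_mul_mul_mul (memLp_stdVec j 4) (memLp_stdVec k 4).star
        (memLp_const (1 : ℂ)) (memLp_const (1 : ℂ))
    · simp only [if_true, if_neg h.symm, one_mul, mul_assoc]

theorem hasExp_stdVec_mul_conj_self_mul (j l : V) :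
    HasExp (stdVec V) (fun w => w j * conj (w j) * (w l * conj (w l)))
      (if j = l then 2 else 1) := by
  rcases eq_or_ne j l with rfl | h
  · simpa using (HasExp.comp_iff (measurePreserving_eval (fun _ : V => stdComplexGaussian) j)
      (f := fun z => z * conj z * (z * conj z)) (by fun_prop)).2
      hasExp_mul_conj_sq_stdComplexGaussian
  · have hind : iIndepFun (fun (v : V) (w : V → ℂ) => w v * conj (w v)) (stdVec V) :=
      iIndepFun_pi (μ := fun _ : V => stdComplexGaussian) (X := fun (_ : V) (z : ℂ) => z * conj z)
        fun _ => by fun_prop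
    simpa [h] using HasExp.mul_of_indepFun (hind.indepFun h) (hasExp_stdVec_mul_conj_self j)
      (hasExp_stdVec_mul_conj_self l)

theorem hasExp_stdVec_four (j k l m : V) :
    HasExp (stdVec V) (fun w => w j * conj (w k) * w l * conj (w m))
      ((if j = k ∧ l = m then 1 else 0) + (if j = m ∧ l = k then 1 else 0)) := by
  by_cases hl : l ≠ k ∧ l ≠ m
  · simpa [hl.1, hl.2] using hasExp_stdVec_four_eq_zero hl
  by_cases hj : j ≠ k ∧ j ≠ m
  · refine (hasExp_stdVec_four_eq_zero (j := l) hj).congr (fun w => by ring) ?_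
    simp [hj.1, hj.2]
  by_cases hk : k ≠ j ∧ k ≠ l
  · refine (hasExp_stdVec_four_eq_zero (j := m) hk).star.congr (fun w => ?_) ?_
    · simp only [map_mul, Complex.conj_conj]; ring
    · simp [hk.1.symm, hk.2.symm]
  have hpair : (k = j ∧ m = l) ∨ (k = l ∧ m = j) ∨ (k = j ∧ k = l ∧ m ≠ j) := by grind
  rcases hpair with ⟨rfl, rfl⟩ | ⟨rfl, rfl⟩ | ⟨rfl, rfl, hm⟩
  · refine (hasExp_stdVec_mul_conj_self_mul k m).congr (fun w => by ring) ?_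
    rcases eq_or_ne k m with rfl | h
    · norm_num
    · simp [h]
  · refine (hasExp_stdVec_mul_conj_self_mul m k).congr (fun w => by ring) ?_
    rcases eq_or_ne m k with rfl | h
    · norm_num
    · simp [h]
  · refine (hasExp_stdVec_four_eq_zero (j := k) ⟨hm, hm⟩).star.congr (fun w => ?_) ?_
    · simp only [map_mul, Complex.conj_conj]; ring
    · simp [hm.symm]

end StdVec

section LinearForms

variable {V : Type*} [Fintype V]

@[fun_prop]
theorem measurable_dotProduct (a : V → ℂ) : Measurable fun w : V → ℂ => a ⬝ᵥ w := by
  unfold dotProduct; fun_prop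

theorem memLp_dotProduct (a : V → ℂ) (p : ℕ) : MemLp (fun w => a ⬝ᵥ w) p (stdVec V) := by
  unfold dotProduct
  exact memLp_finsetSum _ fun v _ => (memLp_stdVec v p).const_mul (a v)

theorem integrable_dotProduct_three (a b c : V → ℂ) :
    Integrable (fun w => (a ⬝ᵥ w) * conj (b ⬝ᵥ w) * (c ⬝ᵥ w)) (stdVec V) := by
  simpa using integrable_mul_mul_mul (memLp_dotProduct a 4) (memLp_dotProduct b 4).star
    (memLp_dotProduct c 4) (memLp_const (1 : ℂ))

theorem measurePreserving_I_smul :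
    MeasurePreserving (fun w : V → ℂ => Complex.I • w) (stdVec V) (stdVec V) := by
  simpa using! measurePreserving_quarter_turn (V := V) fun _ => True

theorem hasExp_dotProduct (a : V → ℂ) : HasExp (stdVec V) (fun w => a ⬝ᵥ w) 0 :=
  .zero_of_comp_eq_mul measurePreserving_I_smul (by fun_prop)
    ((memLp_dotProduct a 1).integrable (by norm_num)) I_ne_one fun w => dotProduct_smul _ _ _

theorem hasExp_dotProduct_mul (a b : V → ℂ) :
    HasExp (stdVec V) (fun w => (a ⬝ᵥ w) * (b ⬝ᵥ w)) 0 := by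
  refine .zero_of_comp_eq_mul measurePreserving_I_smul (c := -1) (by fun_prop) ?_ (by norm_num)
    fun w => ?_
  · simpa using integrable_mul_mul_mul (memLp_dotProduct a 4) (memLp_dotProduct b 4)
      (memLp_const (1 : ℂ)) (memLp_const (1 : ℂ))
  · simp only [dotProduct_smul, smul_eq_mul]
    linear_combination (a ⬝ᵥ w) * (b ⬝ᵥ w) * Complex.I_mul_I

theorem hasExp_dotProduct_three (a b c : V → ℂ) :
    HasExp (stdVec V) (fun w => (a ⬝ᵥ w) * conj (b ⬝ᵥ w) * (c ⬝ᵥ w)) 0 := by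
  refine .zero_of_comp_eq_mul measurePreserving_I_smul (by fun_prop)
    (integrable_dotProduct_three a b c) I_ne_one fun w => ?_
  simp only [dotProduct_smul, smul_eq_mul, map_mul, Complex.conj_I]
  linear_combination
    -Complex.I * (a ⬝ᵥ w) * conj (b ⬝ᵥ w) * (c ⬝ᵥ w) * Complex.I_mul_I

theorem hasExp_dotProduct_mul_conj (a b : V → ℂ) :
    HasExp (stdVec V) (fun w => (a ⬝ᵥ w) * conj (b ⬝ᵥ w)) (a ⬝ᵥ star b) := by
  classical
  refine (HasExp.sum (s := Finset.univ) fun j _ => HasExp.sum (s := Finset.univ) fun k _ =>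
    (hasExp_stdVec_two j k).const_mul (a j * conj (b k))).congr (fun w => ?_) ?_
  · simp only [dotProduct, map_sum, map_mul, Finset.sum_mul_sum]
    exact Finset.sum_congr rfl fun j _ => Finset.sum_congr rfl fun k _ => by ring
  · simp [dotProduct]

theorem hasExp_dotProduct_four (a b c d : V → ℂ) :
    HasExp (stdVec V) (fun w => (a ⬝ᵥ w) * conj (b ⬝ᵥ w) * (c ⬝ᵥ w) * conj (d ⬝ᵥ w))
      ((a ⬝ᵥ star b) * (c ⬝ᵥ star d) + (a ⬝ᵥ star d) * (c ⬝ᵥ star b)) := by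
  classical
  refine (HasExp.sum (s := Finset.univ) fun j _ => HasExp.sum (s := Finset.univ) fun k _ =>
    HasExp.sum (s := Finset.univ) fun l _ => HasExp.sum (s := Finset.univ) fun m _ =>
    (hasExp_stdVec_four j k l m).const_mul
      (a j * conj (b k) * (c l * conj (d m)))).congr (fun w => ?_) ?_
  · simp only [dotProduct, map_sum, map_mul]
    rw [mul_assoc, Finset.sum_mul_sum, Finset.sum_mul_sum, Finset.sum_mul]
    refine Finset.sum_congr rfl fun j _ => ?_
    rw [Finset.sum_mul]
    refine Finset.sum_congr rfl fun k _ => ?_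
    rw [Finset.mul_sum]
    refine Finset.sum_congr rfl fun l _ => ?_
    rw [Finset.mul_sum]
    exact Finset.sum_congr rfl fun m _ => by ring
  · simp only [mul_add, Finset.sum_add_distrib, ite_and, mul_ite, mul_one, mul_zero,
      Finset.sum_ite_irrel, Finset.sum_ite_eq, Finset.mem_univ, if_true, Finset.sum_const_zero,
      dotProduct, Finset.sum_mul_sum, Pi.star_apply, RCLike.star_def]
    congr 1
    refine Finset.sum_congr rfl fun j _ => Finset.sum_congr rfl fun k _ => ?_
    rw [Finset.sum_ite_eq' _ k, if_pos (Finset.mem_univ k)]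
    ring

end LinearForms

/-! ### Jointly circularly symmetric Gaussian random variables -/

section Circular

variable {Ω : Type*} [MeasurableSpace Ω] {P : Measure Ω}

/-- The second moment `E[x ȳ]`; the covariance when `x` and `y` are centred. -/
def cov (P : Measure Ω) (x y : Ω → ℂ) : ℂ := ∫ ω, x ω * conj (y ω) ∂P

/-- The members of `E` have the moments, up to order four, of jointly Gaussian circularly symmetric
random variables. `four` is Wick's formula. -/
structure IsCircular (P : Measure Ω) (E : Submodule ℂ (Ω → ℂ)) : Prop where
  one (x : E) : HasExp P x 0
  two (x y : E) : HasExp P (fun ω => x.1 ω * conj (y.1 ω)) (cov P x y)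
  pseudo (x y : E) : HasExp P (fun ω => x.1 ω * y.1 ω) 0
  three (x y z : E) : HasExp P (fun ω => x.1 ω * conj (y.1 ω) * z.1 ω) 0
  four (x y z w : E) : HasExp P (fun ω => x.1 ω * conj (y.1 ω) * z.1 ω * conj (w.1 ω))
    (cov P x y * cov P z w + cov P x w * cov P z y)

theorem conj_cov (x y : Ω → ℂ) : conj (cov P x y) = cov P y x := by
  rw [cov, cov, ← integral_conj]
  simp [mul_comm]

namespace IsCircular

variable {E F : Submodule ℂ (Ω → ℂ)}

theorem mono (hE : IsCircular P E) (hF : F ≤ E) : IsCircular P F where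
  one x := hE.one ⟨x, hF x.2⟩
  two x y := hE.two ⟨x, hF x.2⟩ ⟨y, hF y.2⟩
  pseudo x y := hE.pseudo ⟨x, hF x.2⟩ ⟨y, hF y.2⟩
  three x y z := hE.three ⟨x, hF x.2⟩ ⟨y, hF y.2⟩ ⟨z, hF z.2⟩
  four x y z w := hE.four ⟨x, hF x.2⟩ ⟨y, hF y.2⟩ ⟨z, hF z.2⟩ ⟨w, hF w.2⟩

variable (hE : IsCircular P E)
include hE

theorem cov_add_left (x y z : E) :
    cov P (x + y : E) z = cov P x z + cov P y z :=
  (((hE.two x z).add (hE.two y z)).congr (fun _ => add_mul _ _ _) rfl).2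

theorem cov_smul_left (c : ℂ) (x z : E) : cov P (c • x : E) z = c * cov P x z :=
  (((hE.two x z).const_mul c).congr (fun _ => mul_assoc _ _ _) rfl).2

theorem cov_sum_left {ι : Type*} (s : Finset ι) (x : ι → E) (z : E) :
    cov P (∑ i ∈ s, x i : E) z = ∑ i ∈ s, cov P (x i) z :=
  ((HasExp.sum fun i _ => hE.two (x i) z).congr (fun ω => by
    rw [AddSubmonoidClass.coe_finsetSum, Finset.sum_apply, Finset.sum_mul]) rfl).2

end IsCircular

variable {V : Type*} [Fintype V] {x : Ω → V → ℂ} {R A : Matrix V V ℂ}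

theorem hasExp_comp_iff_of_map_eq (hx : Measurable x)
    (hA : P.map x = (stdVec V).map (fun w => 0 + A *ᵥ w)) {F : (V → ℂ) → ℂ} (hF : Measurable F)
    {u : ℂ} : HasExp P (fun ω => F (x ω)) u ↔ HasExp (stdVec V) (fun w => F (A *ᵥ w)) u := by
  have hmul : Measurable fun w : V → ℂ => A *ᵥ w := by unfold Matrix.mulVec; fun_prop
  simp only [zero_add] at hA
  exact (HasExp.comp_iff ⟨hx, rfl⟩ hF).trans (HasExp.comp_iff ⟨hmul, hA.symm⟩ hF).symm

theorem vecMul_dotProduct_star_vecMul (hA : A * Aᴴ = R) (a b : V → ℂ) :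
    (a ᵥ* A) ⬝ᵥ star (b ᵥ* A) = a ⬝ᵥ R *ᵥ star b := by
  rw [Matrix.star_vecMul, ← Matrix.dotProduct_mulVec, Matrix.mulVec_mulVec, hA]

theorem IsCN.hasExp_two (hx : IsCN x 0 R P) (a b : V → ℂ) :
    HasExp P (fun ω => (a ⬝ᵥ x ω) * conj (b ⬝ᵥ x ω)) (a ⬝ᵥ R *ᵥ star b) := by
  obtain ⟨hm, A, hAA, hA⟩ := hx
  refine (hasExp_comp_iff_of_map_eq hm hA
    (F := fun w => (a ⬝ᵥ w) * conj (b ⬝ᵥ w)) (by fun_prop)).2 ?_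
  simpa only [Matrix.dotProduct_mulVec, vecMul_dotProduct_star_vecMul hAA] using
    hasExp_dotProduct_mul_conj (a ᵥ* A) (b ᵥ* A)

theorem IsCN.cov_apply (hx : IsCN x 0 R P) (u v : V) :
    cov P (fun ω => x ω u) (fun ω => x ω v) = R u v := by
  classical
  have h := (hx.hasExp_two (Pi.single u 1) (Pi.single v 1)).2
  simpa [cov, ← Pi.single_star] using h

theorem IsCN.isCircular (hx : IsCN x 0 R P) :
    IsCircular P (Submodule.span ℂ (Set.range fun v ω => x ω v)) := by
  obtain ⟨hm, A, hAA, hA⟩ := id hx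
  have hlin (y : Submodule.span ℂ (Set.range fun v ω => x ω v)) :
      ∃ a : V → ℂ, y.1 = fun ω => a ⬝ᵥ x ω := by
    obtain ⟨a, ha⟩ := (Submodule.mem_span_range_iff_exists_fun ℂ).1 y.2
    exact ⟨a, by ext ω; simp [← ha, dotProduct, Finset.sum_apply]⟩
  have hcov (a b : V → ℂ) : cov P (fun ω => a ⬝ᵥ x ω) (fun ω => b ⬝ᵥ x ω)
      = (a ᵥ* A) ⬝ᵥ star (b ᵥ* A) := by
    rw [vecMul_dotProduct_star_vecMul hAA]; exact (hx.hasExp_two a b).2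
  choose a ha using hlin
  constructor
  · intro y
    rw [ha y]
    exact (hasExp_comp_iff_of_map_eq hm hA (by fun_prop)).2
      (by simpa only [Matrix.dotProduct_mulVec] using hasExp_dotProduct (a y ᵥ* A))
  · intro y z
    rw [ha y, ha z]
    exact ⟨(hx.hasExp_two (a y) (a z)).1, rfl⟩
  · intro y z
    rw [ha y, ha z]
    exact (hasExp_comp_iff_of_map_eq hm hA (F := fun w => (a y ⬝ᵥ w) * (a z ⬝ᵥ w))
      (by fun_prop)).2
      (by simpa only [Matrix.dotProduct_mulVec] using hasExp_dotProduct_mul (a y ᵥ* A) (a z ᵥ* A))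
  · intro y z u
    rw [ha y, ha z, ha u]
    exact (hasExp_comp_iff_of_map_eq hm hA
      (F := fun w => (a y ⬝ᵥ w) * conj (a z ⬝ᵥ w) * (a u ⬝ᵥ w)) (by fun_prop)).2
      (by simpa only [Matrix.dotProduct_mulVec] using
        hasExp_dotProduct_three (a y ᵥ* A) (a z ᵥ* A) (a u ᵥ* A))
  · intro y z u t
    rw [ha y, ha z, ha u, ha t]
    simp only [hcov]
    exact (hasExp_comp_iff_of_map_eq hm hA (F := fun w =>
      (a y ⬝ᵥ w) * conj (a z ⬝ᵥ w) * (a u ⬝ᵥ w) * conj (a t ⬝ᵥ w)) (by fun_prop)).2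
      (by simpa only [Matrix.dotProduct_mulVec] using
        hasExp_dotProduct_four (a y ᵥ* A) (a z ᵥ* A) (a u ᵥ* A) (a t ᵥ* A))

end Circular

section Chaos

variable {Ω : Type*} [MeasurableSpace Ω] {P : Measure Ω} {E : Submodule ℂ (Ω → ℂ)}

namespace IsCircular

variable (hE : IsCircular P E)
include hE

theorem hasExp_linear (a b : ℂ) (x y : E) :
    HasExp P (fun ω => a * x.1 ω + b * conj (y.1 ω)) 0 :=
  (((hE.one x).const_mul a).add ((hE.one y).star.const_mul b)).congr (fun _ => rfl) (by simp)

theorem hasExp_quadratic [IsProbabilityMeasure P] (x y : E) :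
    HasExp P (fun ω => conj (y.1 ω) * x.1 ω - cov P x y) 0 :=
  ((hE.two x y).add (HasExp.const (-cov P x y))).congr (fun ω => by ring) (by ring)

theorem hasExp_linear_mul_conj_linear (a b c d : ℂ) (x y x' y' : E) :
    HasExp P (fun ω => (a * x.1 ω + b * conj (y.1 ω)) * conj (c * x'.1 ω + d * conj (y'.1 ω)))
      (a * conj c * cov P x x' + b * conj d * cov P y' y) := by
  refine ((((hE.two x x').const_mul (a * conj c)).add ((hE.two y' y).const_mul (b * conj d))).add
    (((hE.pseudo x y').const_mul (a * conj d)).add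
      ((hE.pseudo y x').star.const_mul (b * conj c)))).congr (fun ω => ?_) (by simp)
  simp only [map_add, map_mul, Complex.conj_conj]
  ring

theorem hasExp_linear_mul_conj_quadratic (a b : ℂ) (x y x' y' : E) :
    HasExp P (fun ω => (a * x.1 ω + b * conj (y.1 ω))
      * conj (conj (y'.1 ω) * x'.1 ω - cov P x' y')) 0 := by
  refine ((((hE.three x x' y').const_mul a).add ((hE.three y y' x').star.const_mul b)).add
    ((hE.hasExp_linear a b x y).const_mul (-conj (cov P x' y')))).congr (fun ω => ?_) (by simp)
  simp only [map_sub, map_mul, Complex.conj_conj]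
  ring

theorem hasExp_quadratic_mul_conj_quadratic [IsProbabilityMeasure P] (x y x' y' : E) :
    HasExp P (fun ω => (conj (y.1 ω) * x.1 ω - cov P x y)
      * conj (conj (y'.1 ω) * x'.1 ω - cov P x' y')) (cov P x x' * cov P y' y) := by
  refine (((hE.four x y y' x').add ((hE.two x y).const_mul (-cov P y' x'))).add
    ((hE.hasExp_quadratic x' y').star.const_mul (-cov P x y))).congr (fun ω => ?_)
    (by rw [map_zero]; ring)
  simp only [map_sub, map_mul, Complex.conj_conj, conj_cov]
  ring

theorem hasExp_noncentred_two [IsProbabilityMeasure P] (α β : ℂ) (x y : E) :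
    HasExp P (fun ω => conj (α + y.1 ω) * (β + x.1 ω)) (conj α * β + cov P x y) := by
  refine ((HasExp.const (conj α * β + cov P x y)).add ((hE.hasExp_linear (conj α) β x y).add
    (hE.hasExp_quadratic x y))).congr (fun ω => ?_) (by ring)
  rw [map_add]
  ring

/-- Split each factor into a constant, a linear and a centred quadratic part; parts of different
degree are uncorrelated. -/
theorem hasExp_noncentred_four [IsProbabilityMeasure P] (α β γ δ : ℂ) (x y x' y' : E) :
    HasExp P (fun ω => conj (α + y.1 ω) * (β + x.1 ω) * conj (conj (γ + y'.1 ω) * (δ + x'.1 ω)))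
      ((conj α * β + cov P x y) * conj (conj γ * δ + cov P x' y')
        + (conj α * γ * cov P x x' + β * conj δ * cov P y' y) + cov P x x' * cov P y' y) := by
  set m := conj α * β + cov P x y
  set m' := conj γ * δ + cov P x' y'
  have hL := hE.hasExp_linear (conj α) β x y
  have hL' := hE.hasExp_linear (conj γ) δ x' y'
  have hQ := hE.hasExp_quadratic x y
  have hQ' := hE.hasExp_quadratic x' y'
  have hLL := hE.hasExp_linear_mul_conj_linear (conj α) β (conj γ) δ x y x' y'
  have hQQ := hE.hasExp_quadratic_mul_conj_quadratic x y x' y'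
  have hLQ := hE.hasExp_linear_mul_conj_quadratic (conj α) β x y x' y'
  have hQL := (hE.hasExp_linear_mul_conj_quadratic (conj γ) δ x' y' x y).star
  have hconst := HasExp.const (P := P) (m * conj m')
  have hfirst := ((hL.add hQ).const_mul (conj m')).add ((hL'.add hQ').star.const_mul m)
  refine ((hconst.add hfirst).add ((hLL.add hQQ).add (hLQ.add hQL))).congr (fun ω => ?_) ?_
  · simp only [m, m', map_add, map_sub, map_mul, Complex.conj_conj]
    ring
  · simp only [map_add, map_zero, Complex.conj_conj]
    ring

end IsCircular

end Chaos

section CrossCov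

variable {Ω : Type*} [MeasurableSpace Ω] {P : Measure Ω} {E : Submodule ℂ (Ω → ℂ)}
  {ι κ μ : Type*}

/-- The cross-covariance matrix `E[x yᴴ]` of centred random vectors. -/
def crossCov (P : Measure Ω) (x : ι → E) (y : κ → E) : Matrix ι κ ℂ :=
  Matrix.of fun a b => cov P (x a) (y b)

/-- The random vector `D x`. -/
def linTransform [Fintype ι] (D : Matrix κ ι ℂ) (x : ι → E) : κ → E :=
  fun a => ∑ b, D a b • x b

theorem conjTranspose_crossCov (x : ι → E) (y : κ → E) :
    (crossCov P x y)ᴴ = crossCov P y x := by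
  ext a b
  exact conj_cov _ _

theorem crossCov_sumElim {ι' κ' : Type*} (x : ι → E) (x' : ι' → E) (y : κ → E) (y' : κ' → E) :
    crossCov P (Sum.elim x x') (Sum.elim y y')
      = Matrix.fromBlocks (crossCov P x y) (crossCov P x y') (crossCov P x' y)
          (crossCov P x' y') := by
  ext (a | a) (b | b) <;> rfl

namespace IsCircular

variable (hE : IsCircular P E)
include hE

theorem crossCov_add_left (x x' : ι → E) (y : κ → E) :
    crossCov P (x + x') y = crossCov P x y + crossCov P x' y := by
  ext a b
  exact hE.cov_add_left _ _ _

theorem crossCov_smul_left (c : ℂ) (x : ι → E) (y : κ → E) :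
    crossCov P (c • x) y = c • crossCov P x y := by
  ext a b
  exact hE.cov_smul_left _ _ _

theorem crossCov_sum_left {J : Type*} (s : Finset J) (x : J → ι → E) (y : κ → E) :
    crossCov P (∑ j ∈ s, x j) y = ∑ j ∈ s, crossCov P (x j) y := by
  ext a b
  simp only [crossCov, Matrix.of_apply, Matrix.sum_apply, Finset.sum_apply, hE.cov_sum_left]

theorem crossCov_linTransform_left [Fintype ι] (D : Matrix μ ι ℂ) (x : ι → E) (y : κ → E) :
    crossCov P (linTransform D x) y = D * crossCov P x y := by
  ext a b
  simp only [crossCov, linTransform, Matrix.of_apply, Matrix.mul_apply, hE.cov_sum_left,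
    hE.cov_smul_left]

theorem crossCov_add_right (x : ι → E) (y y' : κ → E) :
    crossCov P x (y + y') = crossCov P x y + crossCov P x y' := by
  simp only [← conjTranspose_crossCov (y := x), ← Matrix.conjTranspose_add, hE.crossCov_add_left]

theorem crossCov_smul_right (c : ℂ) (x : ι → E) (y : κ → E) :
    crossCov P x (c • y) = conj c • crossCov P x y := by
  rw [← conjTranspose_crossCov, hE.crossCov_smul_left, Matrix.conjTranspose_smul,
    conjTranspose_crossCov, Complex.star_def]

theorem crossCov_sum_right {J : Type*} (s : Finset J) (x : ι → E) (y : J → κ → E) :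
    crossCov P x (∑ j ∈ s, y j) = ∑ j ∈ s, crossCov P x (y j) := by
  simp only [← conjTranspose_crossCov (y := x), ← Matrix.conjTranspose_sum, hE.crossCov_sum_left]

theorem crossCov_linTransform_right [Fintype κ] (D : Matrix μ κ ℂ) (x : ι → E) (y : κ → E) :
    crossCov P x (linTransform D y) = crossCov P x y * Dᴴ := by
  rw [← conjTranspose_crossCov, hE.crossCov_linTransform_left, Matrix.conjTranspose_mul,
    conjTranspose_crossCov]

end IsCircular

end CrossCov

section GaussVec

variable {Ω : Type*} [MeasurableSpace Ω] {P : Measure Ω} {E : Submodule ℂ (Ω → ℂ)}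
  {ι κ : Type*}

/-- A noncentred Gaussian random vector: its mean, and its fluctuation as a family of members of a
space `E` of centred Gaussian random variables. -/
structure GaussVec (E : Submodule ℂ (Ω → ℂ)) (ι : Type*) where
  mean : ι → ℂ
  dev : ι → E

namespace GaussVec

/-- The underlying random vector. -/
def eval (x : GaussVec E ι) (ω : Ω) : ι → ℂ := fun a => x.mean a + (x.dev a).1 ω

variable [Fintype ι] [Fintype κ] [IsProbabilityMeasure P]

theorem hasExp_star_dotProduct (hE : IsCircular P E) (u v : GaussVec E ι) :
    HasExp P (fun ω => star (u.eval ω) ⬝ᵥ v.eval ω)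
      (star u.mean ⬝ᵥ v.mean + (crossCov P v.dev u.dev).trace) :=
  (HasExp.sum fun n _ => hE.hasExp_noncentred_two (u.mean n) (v.mean n) (v.dev n) (u.dev n)).congr
    (fun _ => rfl) Finset.sum_add_distrib.symm

theorem hasExp_star_dotProduct_mul_conj (hE : IsCircular P E) (u v : GaussVec E ι)
    (u' v' : GaussVec E κ) :
    HasExp P (fun ω => (star (u.eval ω) ⬝ᵥ v.eval ω) * conj (star (u'.eval ω) ⬝ᵥ v'.eval ω))
      ((star u.mean ⬝ᵥ v.mean + (crossCov P v.dev u.dev).trace)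
          * conj (star u'.mean ⬝ᵥ v'.mean + (crossCov P v'.dev u'.dev).trace)
        + (star u.mean ⬝ᵥ crossCov P v.dev v'.dev *ᵥ u'.mean
          + star v'.mean ⬝ᵥ crossCov P u'.dev u.dev *ᵥ v.mean)
        + (crossCov P v.dev v'.dev * crossCov P u'.dev u.dev).trace) := by
  have h := HasExp.sum (s := Finset.univ) fun n _ => HasExp.sum (s := Finset.univ) fun m _ =>
    hE.hasExp_noncentred_four (u.mean n) (v.mean n) (u'.mean m) (v'.mean m)
      (v.dev n) (u.dev n) (v'.dev m) (u'.dev m)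
  refine h.congr (fun ω => ?_) ?_
  · simp only [dotProduct, map_sum, Finset.sum_mul_sum]
    rfl
  · simp only [Finset.sum_add_distrib (s := Finset.univ)]
    congr 2
    · simp only [← Finset.sum_mul_sum, ← map_sum, Finset.sum_add_distrib]
      rfl
    · congr 1
      · simp only [dotProduct, Matrix.mulVec, Finset.mul_sum]
        exact Finset.sum_congr rfl fun n _ => Finset.sum_congr rfl fun m _ =>
          mul_left_comm _ _ _ |>.trans (mul_comm _ _)
      · rw [Finset.sum_comm]
        simp only [dotProduct, Matrix.mulVec, Finset.mul_sum]
        exact Finset.sum_congr rfl fun n _ => Finset.sum_congr rfl fun m _ => by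
          simp only [crossCov, Matrix.of_apply, Pi.star_apply, RCLike.star_def]
          ring

end GaussVec

end GaussVec

/-! ### Independent families of Gaussian vectors -/

section Family

variable {Ω : Type*} {J : Type*} {κ : J → Type*}

/-- The linear span of the entries of the vectors `Y j`, `j ∈ s`. -/
def entrySpan (Y : ∀ j, Ω → κ j → ℂ) (s : Set J) : Submodule ℂ (Ω → ℂ) :=
  Submodule.span ℂ {x | ∃ j ∈ s, ∃ a, x = fun ω => Y j ω a}

/-- The entries of `Y j`, as members of `entrySpan Y s`. -/
def entries (Y : ∀ j, Ω → κ j → ℂ) {s : Set J} {j : J} (hj : j ∈ s) (a : κ j) : entrySpan Y s :=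
  ⟨fun ω => Y j ω a, Submodule.subset_span ⟨j, hj, a, rfl⟩⟩

/-- The σ-algebra generated by the vectors `Y j`, `j ∈ s`. -/
abbrev entrySigma (Y : ∀ j, Ω → κ j → ℂ) (s : Set J) : MeasurableSpace Ω :=
  ⨆ j ∈ s, MeasurableSpace.comap (Y j) inferInstance

theorem measurable_of_mem_entrySpan {Y : ∀ j, Ω → κ j → ℂ} {s : Set J} (x : entrySpan Y s) :
    Measurable[entrySigma Y s] x.1 := by
  obtain ⟨x, hx⟩ := x
  induction hx using Submodule.span_induction with
  | mem x hx =>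
    obtain ⟨j, hj, a, rfl⟩ := hx
    exact ((measurable_pi_apply a).comp (comap_measurable (Y j))).mono
      (le_iSup₂_of_le j hj le_rfl) le_rfl
  | zero => exact measurable_const
  | add x y _ _ hx hy => exact hx.add hy
  | smul c x _ hx => exact hx.const_smul c

variable [MeasurableSpace Ω] {P : Measure Ω}

theorem entrySigma_le {Y : ∀ j, Ω → κ j → ℂ} (hm : ∀ j, Measurable (Y j)) (s : Set J) :
    entrySigma Y s ≤ ‹MeasurableSpace Ω› :=
  iSup₂_le fun j _ => (hm j).comap_le

theorem indep_entrySigma_compl {Y : ∀ j, Ω → κ j → ℂ} (hY : iIndepFun Y P)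
    (hm : ∀ j, Measurable (Y j)) (s : Set J) :
    Indep (entrySigma Y s) (entrySigma Y sᶜ) P :=
  indep_iSup_of_disjoint (fun j => (hm j).comap_le) hY disjoint_compl_right

theorem indepFun_of_indep {α β : Type*} [MeasurableSpace α] [MeasurableSpace β]
    {m₁ m₂ : MeasurableSpace Ω} (h : Indep m₁ m₂ P) {f : Ω → α} {g : Ω → β}
    (hf : Measurable[m₁] f) (hg : Measurable[m₂] g) : IndepFun f g P :=
  (IndepFun_iff_Indep f g P).2 (indep_of_indep_of_le_left
    (indep_of_indep_of_le_right h hg.comap_le) hf.comap_le)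

variable [∀ j, Fintype (κ j)] {Y : ∀ j, Ω → κ j → ℂ} {R : ∀ j, Matrix (κ j) (κ j) ℂ}

theorem crossCov_entries_self (hY : ∀ j, IsCN (Y j) 0 (R j) P) {s : Set J} {j : J} (hj : j ∈ s) :
    crossCov P (entries Y hj) (entries Y hj) = R j := by
  ext a b
  exact (hY j).cov_apply a b

theorem measurePreserving_curry [Fintype J] :
    MeasurePreserving (fun (w : (Σ j, κ j) → ℂ) (j : J) (a : κ j) => w ⟨j, a⟩)
      (stdVec (Σ j, κ j)) (Measure.pi fun j => stdVec (κ j)) := by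
  refine ⟨by fun_prop, ?_⟩
  have h := Measure.infinitePi_map_piCurry (fun (j : J) (_ : κ j) => stdComplexGaussian)
  simp only [Measure.infinitePi_eq_pi] at h
  exact h

variable [IsProbabilityMeasure P]

theorem isCN_sigma [Fintype J] [DecidableEq J] (hind : iIndepFun Y P)
    (hY : ∀ j, IsCN (Y j) 0 (R j) P) :
    IsCN (fun ω (q : Σ j, κ j) => Y q.1 ω q.2) 0 (Matrix.blockDiagonal' R) P := by
  choose hm A hAA hA using hY
  refine ⟨by fun_prop, Matrix.blockDiagonal' A, ?_, ?_⟩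
  · rw [Matrix.blockDiagonal'_conjTranspose, ← Matrix.blockDiagonal'_mul, funext hAA]
  have hmA (j : J) : Measurable fun w : κ j → ℂ => 0 + A j *ᵥ w := by
    unfold Matrix.mulVec; fun_prop
  have (j : J) : IsProbabilityMeasure (P.map (Y j)) :=
    Measure.isProbabilityMeasure_map (hm j).aemeasurable
  have hjoint : P.map (fun ω j => Y j ω) = Measure.map
      (fun (w : (Σ j, κ j) → ℂ) j => 0 + A j *ᵥ fun a => w ⟨j, a⟩) (stdVec (Σ j, κ j)) := by
    rw [(iIndepFun_iff_map_fun_eq_pi_map fun j => (hm j).aemeasurable).1 hind]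
    exact ((measurePreserving_pi _ _ fun j => ⟨hmA j, (hA j).symm⟩).comp
      measurePreserving_curry).map_eq.symm
  have huncurry : Measurable fun (y : ∀ j, κ j → ℂ) (q : Σ j, κ j) => y q.1 q.2 := by fun_prop
  have h := congrArg (Measure.map fun (y : ∀ j, κ j → ℂ) (q : Σ j, κ j) => y q.1 q.2) hjoint
  rw [Measure.map_map huncurry (by fun_prop), Measure.map_map huncurry
    (by unfold Matrix.mulVec; fun_prop)] at h
  refine h.trans (congrArg (Measure.map · _) ?_)
  ext w ⟨j, a⟩
  simp [Matrix.mulVec, dotProduct, Fintype.sum_sigma, Matrix.blockDiagonal'_apply, dite_mul]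

variable [Finite J]

theorem isCircular_entrySpan (hind : iIndepFun Y P) (hY : ∀ j, IsCN (Y j) 0 (R j) P)
    (s : Set J) : IsCircular P (entrySpan Y s) := by
  classical
  have := Fintype.ofFinite J
  refine (isCN_sigma hind hY).isCircular.mono (Submodule.span_mono ?_)
  rintro x ⟨j, -, a, rfl⟩
  exact ⟨⟨j, a⟩, rfl⟩

theorem crossCov_entries_of_ne (hind : iIndepFun Y P) (hY : ∀ j, IsCN (Y j) 0 (R j) P) {s : Set J}
    {i j : J} (hi : i ∈ s) (hj : j ∈ s) (hij : i ≠ j) :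
    crossCov P (entries Y hi) (entries Y hj) = 0 := by
  classical
  have := Fintype.ofFinite J
  ext a b
  exact ((isCN_sigma hind hY).cov_apply ⟨i, a⟩ ⟨j, b⟩).trans
    (Matrix.blockDiagonal'_apply_ne R a b hij)

/-- Weighting by independent uncorrelated Gaussians removes the cross terms of a second moment. -/
theorem hasExp_sum_mul_conj_sum (hind : iIndepFun Y P) (hY : ∀ j, IsCN (Y j) 0 (R j) P)
    {s : Set J} {T : Type*} [Fintype T] [DecidableEq T] {w w' : T → entrySpan Y sᶜ} {γ : T → ℂ}
    (hw : crossCov P w w' = Matrix.diagonal γ) {g g' : T → Ω → ℂ}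
    (hg : ∀ t, Measurable[entrySigma Y s] (g t)) (hg' : ∀ t, Measurable[entrySigma Y s] (g' t))
    (hgL : ∀ t, MemLp (g t) 2 P) (hgL' : ∀ t, MemLp (g' t) 2 P) :
    HasExp P (fun ω => (∑ t, (w t).1 ω * g t ω) * conj (∑ t, (w' t).1 ω * g' t ω))
      (∑ t, γ t * ∫ ω, g t ω * conj (g' t ω) ∂P) := by
  have hterm (t t' : T) : HasExp P
      (fun ω => (w t).1 ω * conj ((w' t').1 ω) * (g t ω * conj (g' t' ω)))
      (Matrix.diagonal γ t t' * ∫ ω, g t ω * conj (g' t' ω) ∂P) := by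
    have hww : HasExp P (fun ω => (w t).1 ω * conj ((w' t').1 ω)) (Matrix.diagonal γ t t') :=
      hw ▸ (isCircular_entrySpan hind hY sᶜ).two (w t) (w' t')
    have hgg : HasExp P (fun ω => g t ω * conj (g' t' ω)) (∫ ω, g t ω * conj (g' t' ω) ∂P) :=
      ⟨(hgL t).integrable_mul (hgL' t').star, rfl⟩
    refine hww.mul_of_indepFun (indepFun_of_indep
      (indep_entrySigma_compl hind (fun j => (hY j).1) s).symm ?_ ?_) hgg
    · exact (measurable_of_mem_entrySpan _).mul
        (continuous_star.measurable.comp (measurable_of_mem_entrySpan _))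
    · exact (hg t).mul (continuous_star.measurable.comp (hg' t'))
  refine (HasExp.sum (s := Finset.univ) fun t _ => HasExp.sum (s := Finset.univ) fun t' _ =>
    hterm t t').congr (fun ω => ?_) ?_
  · rw [map_sum, Finset.sum_mul_sum]
    simp only [map_mul, mul_mul_mul_comm]
  · simp [Matrix.diagonal_apply, ite_mul]

end Family

/-! ### Generalized Rayleigh quotients -/

section Rayleigh

variable {𝕜 ι : Type*} [RCLike 𝕜] [Fintype ι]

/-- The generalized Rayleigh quotient `|aᴴ u|² / (aᴴ B a)`, for Hermitian `B`; it is `0` when the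
denominator vanishes. -/
def rayleighQuotient (B : Matrix ι ι 𝕜) (u a : ι → 𝕜) : ℝ :=
  ‖star a ⬝ᵥ u‖ ^ 2 / RCLike.re (star a ⬝ᵥ B *ᵥ a)

theorem norm_sq_star_dotProduct_mulVec_le {B : Matrix ι ι 𝕜} (hB : B.PosSemidef) (x y : ι → 𝕜) :
    ‖star x ⬝ᵥ B *ᵥ y‖ ^ 2
      ≤ RCLike.re (star x ⬝ᵥ B *ᵥ x) * RCLike.re (star y ⬝ᵥ B *ᵥ y) := by
  let := B.toSeminormedAddCommGroup hB
  let := B.toInnerProductSpace hB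
  have hinner (x y : ι → 𝕜) : inner 𝕜 x y = star x ⬝ᵥ B *ᵥ y := dotProduct_comm _ _
  have h := inner_mul_inner_self_le (𝕜 := 𝕜) x y
  rwa [norm_inner_symm y x, ← sq, hinner, hinner, hinner] at h

theorem star_dotProduct_vecMulVec_mulVec (a u : ι → 𝕜) :
    star a ⬝ᵥ Matrix.vecMulVec u (star u) *ᵥ a = ((‖star a ⬝ᵥ u‖ ^ 2 : ℝ) : 𝕜) := by
  rw [Matrix.vecMulVec_mulVec, dotProduct_smul, op_smul_eq_mul, Matrix.star_dotProduct u a,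
    RCLike.star_def, RCLike.mul_conj, RCLike.ofReal_pow]

variable [DecidableEq ι] {B : Matrix ι ι 𝕜} (hB : B.PosDef)
include hB

theorem mulVec_inv_mulVec (u : ι → 𝕜) : B *ᵥ B⁻¹ *ᵥ u = u := by
  rw [Matrix.mulVec_mulVec, Matrix.mul_nonsing_inv _ (B.isUnit_iff_isUnit_det.1 hB.isUnit),
    Matrix.one_mulVec]

theorem inv_mulVec_ne_zero {u : ι → 𝕜} (hu : u ≠ 0) : B⁻¹ *ᵥ u ≠ 0 := fun h =>
  hu (by rw [← mulVec_inv_mulVec hB u, h, Matrix.mulVec_zero])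

theorem star_inv_mulVec_dotProduct (u : ι → 𝕜) :
    star (B⁻¹ *ᵥ u) ⬝ᵥ u = star u ⬝ᵥ B⁻¹ *ᵥ u := by
  rw [Matrix.star_mulVec, hB.inv.isHermitian.eq, ← Matrix.dotProduct_mulVec]

theorem rayleighQuotient_le (u a : ι → 𝕜) :
    rayleighQuotient B u a ≤ RCLike.re (star u ⬝ᵥ B⁻¹ *ᵥ u) := by
  have h := norm_sq_star_dotProduct_mulVec_le hB.posSemidef a (B⁻¹ *ᵥ u)
  rw [mulVec_inv_mulVec hB, star_inv_mulVec_dotProduct hB, mul_comm] at h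
  exact div_le_of_le_mul₀ (hB.posSemidef.re_dotProduct_nonneg a)
    (hB.inv.posSemidef.re_dotProduct_nonneg u) h

theorem rayleighQuotient_inv_mulVec (u : ι → 𝕜) :
    rayleighQuotient B u (B⁻¹ *ᵥ u) = RCLike.re (star u ⬝ᵥ B⁻¹ *ᵥ u) := by
  have hreal : ‖star u ⬝ᵥ B⁻¹ *ᵥ u‖ = RCLike.re (star u ⬝ᵥ B⁻¹ *ᵥ u) := by
    have hnonneg := hB.inv.posSemidef.dotProduct_mulVec_nonneg u
    simpa using congrArg RCLike.re (RCLike.norm_of_nonneg' hnonneg)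
  rw [rayleighQuotient, mulVec_inv_mulVec hB, star_inv_mulVec_dotProduct hB, hreal, sq,
    mul_self_div_self]

end Rayleigh

/-! ### Pilots and deterministic matrices -/

theorem sum_dftPilot_mul_conj {τ : ℕ} (t s : Fin τ) :
    ∑ u, dftPilot τ t u * conj (dftPilot τ s u) = if t = s then (τ : ℂ) else 0 := by
  have hζ := Complex.isPrimitiveRoot_exp τ t.pos.ne'
  set ζ := Complex.exp (2 * Real.pi * Complex.I / τ) with hζdef
  have hterm (u : Fin τ) :
      dftPilot τ t u * conj (dftPilot τ s u) = (ζ ^ (s : ℕ) / ζ ^ (t : ℕ)) ^ (u : ℕ) := by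
    rw [dftPilot, dftPilot, ← Complex.exp_conj, ← Complex.exp_add, hζdef, ← Complex.exp_nat_mul,
      ← Complex.exp_nat_mul, ← Complex.exp_sub, ← Complex.exp_nat_mul]
    congr 1
    simp only [map_neg, map_div₀, map_mul, Complex.conj_I, map_ofNat, Complex.conj_ofReal,
      map_natCast]
    ring
  have hζ0 : ζ ^ (t : ℕ) ≠ 0 := pow_ne_zero _ (Complex.exp_ne_zero _)
  rw [Finset.sum_congr rfl fun u _ => hterm u,
    Fin.sum_univ_eq_sum_range fun u => (ζ ^ (s : ℕ) / ζ ^ (t : ℕ)) ^ u]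
  split_ifs with h
  · simp [h, div_self (h ▸ hζ0)]
  · have hne : ζ ^ (s : ℕ) / ζ ^ (t : ℕ) ≠ 1 := fun h1 =>
      h (Fin.ext (hζ.pow_inj t.isLt s.isLt ((div_eq_one_iff_eq hζ0).1 h1).symm))
    rw [geom_sum_eq hne, div_pow, pow_right_comm, hζ.pow_eq_one, pow_right_comm, hζ.pow_eq_one]
    simp

section DiagPart

variable {ι : Type*} [DecidableEq ι]

theorem posSemidef_diagPart {A : Matrix ι ι ℂ} (hA : A.PosSemidef) : (diagPart A).PosSemidef :=
  Matrix.PosSemidef.diagonal fun _ => hA.diag_nonneg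

variable [Fintype ι]

theorem trace_diagPart_mul (A M : Matrix ι ι ℂ) :
    (diagPart A * M).trace = ∑ n, A n n * M n n := by
  simp [diagPart, Matrix.trace]

theorem star_dotProduct_diagPart_mulVec (A : Matrix ι ι ℂ) (x : ι → ℂ) :
    star x ⬝ᵥ diagPart A *ᵥ x = ∑ n, A n n * (x n * conj (x n)) :=
  Finset.sum_congr rfl fun n _ => by
    simp only [diagPart, Matrix.mulVec_diagonal, Matrix.diag_apply, Pi.star_apply, RCLike.star_def]
    ring

end DiagPart

theorem posSemidef_ofReal_smul {ι : Type*} {A : Matrix ι ι ℂ} (hA : A.PosSemidef) {r : ℝ}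
    (hr : 0 ≤ r) : ((r : ℂ) • A).PosSemidef :=
  hA.smul (by exact_mod_cast hr)

namespace Params

variable {K L N τ : ℕ} (S : Params K L N τ)

/-- The coefficient of the NLOS channel of user `i` in the centred pilot observation. -/
def pilotGain (i : Fin K) : ℝ := (1 - S.ρad) * Real.sqrt (S.pdd i * τ)

/-- The matrix that maps the centred pilot observation to the estimate of the NLOS channel. -/
def estimator (k : Fin K) (l : Fin L) : Matrix (Fin N) (Fin N) ℂ :=
  (S.pilotGain k : ℂ) • (S.R k l * (S.Ψ k l)⁻¹)

/-- The covariance matrix of the estimate of the NLOS channel. -/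
def estCov (k : Fin K) (l : Fin L) : Matrix (Fin N) (Fin N) ℂ :=
  (((1 - S.ρad) ^ 2 * τ * S.pdd k : ℝ) : ℂ) • (S.R k l * (S.Ψ k l)⁻¹ * S.R k l)

/-- The power `E|ĥ_n|²` of the `n`-th entry of the channel estimate. -/
def estPower (k : Fin K) (l : Fin L) (n : Fin N) : ℂ :=
  S.hbar k l n * conj (S.hbar k l n) + S.estCov k l n n

/-- The power `E|x_n|²` of the `n`-th ADC input in the data phase. -/
def adcPower (l : Fin L) (n : Fin N) : ℂ :=
  ∑ i, (S.p i : ℂ) * (S.βLOS i l + S.R i l n n) + (S.σ : ℂ) ^ 2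

/-- The variance of an entry of the thermal and ADC noise in the data phase. -/
def noiseVar (l : Fin L) (n : Fin N) : ℂ :=
  (((1 - S.ρad) ^ 2 * S.σ ^ 2 : ℝ) : ℂ) + ((S.ρad * (1 - S.ρad) : ℝ) : ℂ) * S.adcPower l n

/-- The mean of the vector `g_ki` under MRC. -/
def gMean (k i : Fin K) : S.cluster k → ℂ :=
  S.lamVec k i + if i ∈ S.sharing k then S.bVec k i else 0

variable {S}

theorem c_eq (k i : Fin K) (l : Fin L) :
    S.c k i l = star (S.hbar k l) ⬝ᵥ S.R i l *ᵥ S.hbar k l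
      + star (S.hbar i l) ⬝ᵥ S.estCov k l *ᵥ S.hbar i l + (S.R i l * S.estCov k l).trace := by
  simp only [c, estCov, Matrix.mul_smul, Matrix.trace_smul, Matrix.smul_mulVec, dotProduct_smul,
    smul_eq_mul, Matrix.mul_assoc]
  ring

theorem mem_sharing {k i : Fin K} : i ∈ S.sharing k ↔ S.pilot i = S.pilot k := by
  simp [sharing]

theorem gMean_self (k : Fin K) : S.gMean k k = S.lamVec k k + S.bVec k k := by
  simp [gMean, mem_sharing]

namespace Valid

variable (hS : S.Valid)
include hS

theorem one_sub_ρad_pos : 0 < 1 - S.ρad := sub_pos.2 hS.ρad_lt_one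

theorem one_sub_ρda_pos : 0 < 1 - S.ρda := sub_pos.2 hS.ρda_lt_one

theorem pdd_nonneg (i : Fin K) : 0 ≤ S.pdd i :=
  mul_nonneg hS.one_sub_ρda_pos.le (hS.p_nonneg i)

theorem pdd_pos {i : Fin K} (hp : 0 < S.p i) : 0 < S.pdd i := mul_pos hS.one_sub_ρda_pos hp

theorem βLOS_nonneg (i : Fin K) (l : Fin L) : 0 ≤ S.βLOS i l :=
  div_nonneg (mul_nonneg (hS.κ_nonneg i l) (hS.β_nonneg i l)) (by linarith [hS.κ_nonneg i l])

theorem pilotGain_mul (k i : Fin K) :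
    S.pilotGain k * S.pilotGain i = (1 - S.ρad) ^ 2 * τ * Real.sqrt (S.pdd k * S.pdd i) := by
  rw [pilotGain, pilotGain, mul_mul_mul_comm, ← Real.sqrt_mul (mul_nonneg (hS.pdd_nonneg k)
    τ.cast_nonneg), mul_mul_mul_comm, mul_comm (S.pdd k * S.pdd i),
    Real.sqrt_mul (mul_self_nonneg _), Real.sqrt_mul_self τ.cast_nonneg]
  ring

theorem pilotGain_mul_self (k : Fin K) :
    S.pilotGain k * S.pilotGain k = (1 - S.ρad) ^ 2 * τ * S.pdd k := by
  rw [hS.pilotGain_mul, Real.sqrt_mul_self (hS.pdd_nonneg k)]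

theorem hbar_mul_conj (i : Fin K) (l : Fin L) (n : Fin N) :
    S.hbar i l n * conj (S.hbar i l n) = S.βLOS i l := by
  have h : ‖S.hbar i l n‖ ^ 2 = S.βLOS i l := by
    have h1 : ‖Complex.exp (-(Complex.I * (n : ℕ) * (Real.pi : ℂ) * (Real.sin (S.θ i l) : ℂ)))‖
        = 1 := by
      rw [Complex.norm_exp]
      simp
    rw [hbar, norm_mul, h1, mul_one, Complex.norm_real, Real.norm_eq_abs, sq_abs,
      Real.sq_sqrt (hS.βLOS_nonneg i l)]
  rw [Complex.mul_conj, Complex.normSq_eq_norm_sq, h]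

theorem posSemidef_gram (l : Fin L) : (S.gram l).PosSemidef :=
  Matrix.posSemidef_sum _ fun i _ => posSemidef_ofReal_smul
    ((Matrix.posSemidef_vecMulVec_self_star _).add (hS.R_posSemidef i l)) (hS.pdd_nonneg i)

theorem posDef_Ψ (k : Fin K) (l : Fin L) : (S.Ψ k l).PosDef := by
  have had := hS.one_sub_ρad_pos
  have hda := hS.one_sub_ρda_pos
  have had' := hS.ρad_nonneg
  have hda' := hS.ρda_nonneg
  have hσ := hS.σ_pos
  have hsum : (∑ i ∈ S.sharing k, ((S.pdd i * τ : ℝ) : ℂ) • S.R i l).PosSemidef :=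
    Matrix.posSemidef_sum _ fun i _ => posSemidef_ofReal_smul (hS.R_posSemidef i l)
      (mul_nonneg (hS.pdd_nonneg i) τ.cast_nonneg)
  have hthermal : ((((1 - S.ρad) * S.σ ^ 2 : ℝ) : ℂ) • (1 : Matrix (Fin N) (Fin N) ℂ)).PosDef :=
    Matrix.PosDef.one.smul (by exact_mod_cast (by positivity : 0 < (1 - S.ρad) * S.σ ^ 2))
  have hdistortion := (posSemidef_ofReal_smul (hS.posSemidef_gram l)
    (by positivity : 0 ≤ (1 - S.ρad) ^ 2 * S.ρda / (1 - S.ρda))).add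
    (posSemidef_ofReal_smul (posSemidef_diagPart (hS.posSemidef_gram l))
      (by positivity : 0 ≤ S.ρad * (1 - S.ρad) / (1 - S.ρda)))
  exact .posSemidef_add (posSemidef_ofReal_smul hsum (by positivity))
    (.posSemidef_add hdistortion hthermal)

theorem conjTranspose_estimator (k : Fin K) (l : Fin L) :
    (S.estimator k l)ᴴ = (S.pilotGain k : ℂ) • ((S.Ψ k l)⁻¹ * S.R k l) := by
  rw [estimator, Matrix.conjTranspose_smul, Matrix.conjTranspose_mul,
    (hS.posDef_Ψ k l).inv.isHermitian.eq, (hS.R_posSemidef k l).isHermitian.eq, Complex.star_def,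
    Complex.conj_ofReal]

theorem estimator_mul_Ψ_mul (k : Fin K) (l : Fin L) :
    S.estimator k l * S.Ψ k l * (S.estimator k l)ᴴ = S.estCov k l := by
  have hdet : IsUnit (S.Ψ k l).det := (Matrix.isUnit_iff_isUnit_det _).1 (hS.posDef_Ψ k l).isUnit
  rw [hS.conjTranspose_estimator, estimator, estCov, ← hS.pilotGain_mul_self, Matrix.smul_mul,
    Matrix.smul_mul, Matrix.mul_smul, smul_smul, ← Complex.ofReal_mul, Matrix.mul_assoc (S.R k l),
    Matrix.nonsing_inv_mul _ hdet, Matrix.mul_one, ← Matrix.mul_assoc]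

theorem pilotGain_mul_trace (k i : Fin K) (l : Fin L) :
    (S.pilotGain i : ℂ) * (S.R i l * (S.estimator k l)ᴴ).trace = S.b k i l := by
  rw [hS.conjTranspose_estimator, Matrix.mul_smul, Matrix.trace_smul, smul_eq_mul, ← mul_assoc,
    ← Complex.ofReal_mul, mul_comm (S.pilotGain i), hS.pilotGain_mul, b, Matrix.mul_assoc]

theorem posSemidef_estCov (k : Fin K) (l : Fin L) : (S.estCov k l).PosSemidef := by
  rw [← hS.estimator_mul_Ψ_mul]
  exact (hS.posDef_Ψ k l).posSemidef.mul_mul_conjTranspose_same _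

theorem noiseVar_eq (l : Fin L) (n : Fin N) :
    S.noiseVar l n
      = ((S.ρad * (1 - S.ρad) / (1 - S.ρda) : ℝ) : ℂ) * (∑ i, (S.pdd i : ℂ) • S.R i l) n n
        + (((1 - S.ρad) * (S.σ ^ 2 + S.ρad / (1 - S.ρda) *
          ∑ i, S.pdd i * S.β i l * S.κ i l / (S.κ i l + 1)) : ℝ) : ℂ) := by
  have hda : (1 - S.ρda : ℂ) ≠ 0 := by exact_mod_cast hS.one_sub_ρda_pos.ne'
  have hlos : ∑ i, S.pdd i * S.β i l * S.κ i l / (S.κ i l + 1)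
      = (1 - S.ρda) * ∑ i, S.p i * S.βLOS i l := by
    rw [Finset.mul_sum]
    exact Finset.sum_congr rfl fun i _ => by rw [pdd, βLOS]; ring
  have hR : (∑ i, (S.pdd i : ℂ) • S.R i l) n n = (1 - S.ρda) * ∑ i, S.p i * S.R i l n n := by
    rw [Matrix.sum_apply, Finset.mul_sum]
    exact Finset.sum_congr rfl fun i _ => by simp [pdd, mul_assoc]
  rw [hlos, hR, noiseVar, adcPower]
  simp only [mul_add, Finset.sum_add_distrib]
  push_cast
  field_simp
  ring

theorem d_eq (k : Fin K) (l : Fin L) :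
    S.d k l = ∑ n, S.noiseVar l n * S.estPower k l n := by
  have hassoc (A : Matrix (Fin N) (Fin N) ℂ) :
      A * S.R k l * (S.Ψ k l)⁻¹ * S.R k l = A * (S.R k l * (S.Ψ k l)⁻¹ * S.R k l) := by
    simp only [Matrix.mul_assoc]
  rw [d, hassoc, trace_diagPart_mul, star_dotProduct_diagPart_mulVec]
  simp only [hS.noiseVar_eq, estPower, estCov, dotProduct, Matrix.trace, Matrix.diag_apply,
    Pi.star_apply, RCLike.star_def, Matrix.smul_apply, smul_eq_mul]
  simp only [Finset.mul_sum, ← Finset.sum_add_distrib]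
  refine Finset.sum_congr rfl fun n _ => ?_
  push_cast
  ring

end Valid

end Params

/-! ### The matrix `C_k` -/

theorem eq_zero_of_mul_posDef_mul {ι : Type*} [Fintype ι] {R A : Matrix ι ι ℂ}
    (hR : R.IsHermitian) (hA : A.PosDef) (h : R * A * R = 0) : R = 0 := by
  classical
  refine Matrix.ext_of_mulVec_single fun j => ?_
  rw [Matrix.zero_mulVec]
  by_contra hne
  refine (hA.dotProduct_mulVec_pos hne).ne' ?_
  rw [Matrix.star_mulVec, hR.eq, ← Matrix.dotProduct_mulVec, Matrix.mulVec_mulVec,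
    Matrix.mulVec_mulVec, h, Matrix.zero_mulVec, dotProduct_zero]

open scoped MatrixOrder in
theorem trace_mul_nonneg {ι : Type*} [Fintype ι] {A B : Matrix ι ι ℂ} (hA : A.PosSemidef)
    (hB : B.PosSemidef) : 0 ≤ (A * B).trace := by
  classical
  obtain ⟨M, rfl⟩ := CStarAlgebra.nonneg_iff_eq_star_mul_self.1 hA.nonneg
  rw [Matrix.mul_assoc, Matrix.trace_mul_comm, Matrix.star_eq_conjTranspose]
  exact (hB.mul_mul_conjTranspose_same M).trace_nonneg

namespace Params.Valid

variable {K L N τ : ℕ} {S : Params K L N τ} (hS : S.Valid)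
include hS

theorem noiseVar_pos (l : Fin L) (n : Fin N) : 0 < S.noiseVar l n := by
  have had := hS.one_sub_ρad_pos
  have had' := hS.ρad_nonneg
  have hσ := hS.σ_pos
  have hsignal : 0 ≤ S.adcPower l n := add_nonneg (Finset.sum_nonneg fun i _ =>
    mul_nonneg (by exact_mod_cast hS.p_nonneg i) (add_nonneg
      (by exact_mod_cast hS.βLOS_nonneg i l) (hS.R_posSemidef i l).diag_nonneg))
    (by exact_mod_cast sq_nonneg S.σ)
  exact add_pos_of_pos_of_nonneg (by exact_mod_cast (by positivity))
    (mul_nonneg (by exact_mod_cast (by positivity)) hsignal)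

theorem estPower_nonneg (k : Fin K) (l : Fin L) (n : Fin N) : 0 ≤ S.estPower k l n :=
  add_nonneg (mul_star_self_nonneg _) (hS.posSemidef_estCov k l).diag_nonneg

theorem estCov_ne_zero {k : Fin K} {l : Fin L} (hp : 0 < S.p k) (hR : S.R k l ≠ 0) :
    S.estCov k l ≠ 0 := by
  have had := hS.one_sub_ρad_pos
  have hpdd := hS.pdd_pos hp
  have hτ : 0 < τ := (S.pilot k).pos
  have hgain : (1 - S.ρad) ^ 2 * τ * S.pdd k ≠ 0 := by positivity
  exact fun h => hR (eq_zero_of_mul_posDef_mul (hS.R_posSemidef k l).isHermitian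
    (hS.posDef_Ψ k l).inv ((smul_eq_zero.1 h).resolve_left (by exact_mod_cast hgain)))

theorem exists_estPower_pos {k : Fin K} {l : Fin L} (hp : 0 < S.p k)
    (hne : S.hbar k l ≠ 0 ∨ S.R k l ≠ 0) : ∃ n, 0 < S.estPower k l n := by
  by_contra! hle
  have hzero (n : Fin N) : S.hbar k l n * conj (S.hbar k l n) = 0 ∧ S.estCov k l n n = 0 :=
    (add_eq_zero_iff_of_nonneg (mul_star_self_nonneg (S.hbar k l n))
      (hS.posSemidef_estCov k l).diag_nonneg).1
      ((hS.estPower_nonneg k l n).eq_or_lt.resolve_right (hle n)).symm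
  rcases hne with hbar | hR
  · exact hbar (funext fun n => by simpa using (hzero n).1)
  · exact hS.estCov_ne_zero hp hR ((hS.posSemidef_estCov k l).trace_eq_zero_iff.1
      (Finset.sum_eq_zero fun n _ => (hzero n).2))

theorem d_pos {k : Fin K} {l : Fin L} (hp : 0 < S.p k) (hne : S.hbar k l ≠ 0 ∨ S.R k l ≠ 0) :
    0 < S.d k l := by
  obtain ⟨n, hn⟩ := hS.exists_estPower_pos hp hne
  rw [hS.d_eq]
  exact Finset.sum_pos' (fun m _ => mul_nonneg (hS.noiseVar_pos l m).le (hS.estPower_nonneg k l m))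
    ⟨n, Finset.mem_univ n, mul_pos (hS.noiseVar_pos l n) hn⟩

theorem gMean_self_apply (k : Fin K) (l : S.cluster k) :
    S.gMean k k l = ∑ n, S.estPower k l n := by
  rw [gMean_self, Pi.add_apply, lamVec, bVec, lam, b, Real.sqrt_mul_self (hS.pdd_nonneg k)]
  simp only [estPower, estCov, Finset.sum_add_distrib, Matrix.smul_apply, smul_eq_mul,
    ← Finset.mul_sum]
  rw [dotProduct_comm]
  rfl

theorem gMean_self_ne_zero {k : Fin K} (hp : 0 < S.p k) (hM : (S.cluster k).Nonempty)
    (hne : ∀ l ∈ S.cluster k, S.hbar k l ≠ 0 ∨ S.R k l ≠ 0) : S.gMean k k ≠ 0 := by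
  obtain ⟨l, hl⟩ := hM
  obtain ⟨n, hn⟩ := hS.exists_estPower_pos hp (hne l hl)
  refine Function.ne_iff.2 ⟨⟨l, hl⟩, ne_of_gt ?_⟩
  rw [hS.gMean_self_apply]
  exact Finset.sum_pos' (fun m _ => hS.estPower_nonneg k l m) ⟨n, Finset.mem_univ n, hn⟩

theorem c_nonneg (k i : Fin K) (l : Fin L) : 0 ≤ S.c k i l := by
  rw [c_eq]
  exact add_nonneg (add_nonneg ((hS.R_posSemidef i l).dotProduct_mulVec_nonneg _)
    ((hS.posSemidef_estCov k l).dotProduct_mulVec_nonneg _))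
    (trace_mul_nonneg (hS.R_posSemidef i l) (hS.posSemidef_estCov k l))

end Params.Valid

namespace Params

variable {K L N τ : ℕ} (S : Params K L N τ)

/-- The second-moment matrix `E[g_ki g_kiᴴ]` under MRC. -/
def gOuter (k i : Fin K) : Matrix (S.cluster k) (S.cluster k) ℂ :=
  Matrix.vecMulVec (S.gMean k i) (star (S.gMean k i))
    + Matrix.diagonal fun l : S.cluster k => S.c k i l

variable {S}

theorem gOuter_eq (k i : Fin K) :
    S.gOuter k i = Matrix.vecMulVec (S.lamVec k i) (star (S.lamVec k i))
        + Matrix.diagonal (fun l : S.cluster k => S.c k i l)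
      + if i ∈ S.sharing k then
          Matrix.vecMulVec (S.bVec k i) (star (S.bVec k i))
            + Matrix.vecMulVec (S.bVec k i) (star (S.lamVec k i))
            + Matrix.vecMulVec (S.lamVec k i) (star (S.bVec k i))
        else 0 := by
  unfold gOuter gMean
  split_ifs
  · rw [star_add, Matrix.vecMulVec_add, Matrix.add_vecMulVec, Matrix.add_vecMulVec]
    abel
  · simp only [add_zero]

namespace Valid

variable (hS : S.Valid)
include hS

theorem C_eq (k : Fin K) :
    S.C k = ∑ i, (((1 - S.ρad) ^ 2 * S.p i : ℝ) : ℂ) • S.gOuter k i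
      - (((1 - S.ρad) ^ 2 * S.pdd k : ℝ) : ℂ) •
          Matrix.vecMulVec (S.gMean k k) (star (S.gMean k k))
      + Matrix.diagonal fun l : S.cluster k => S.d k l := by
  have hpower (i : Fin K) :
      (1 - S.ρad) ^ 2 * S.p i = (1 - S.ρad) ^ 2 / (1 - S.ρda) * S.pdd i := by
    have := hS.one_sub_ρda_pos.ne'
    rw [pdd]
    field_simp
  simp only [hpower, C, gMean_self, gOuter_eq, Complex.ofReal_mul, ← smul_smul,
    ← Finset.smul_sum, smul_add _ _ (ite _ _ _), Finset.sum_add_distrib, smul_ite, smul_zero,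
    Finset.sum_ite_mem, Finset.univ_inter]
  rw [smul_add]

theorem posDef_C {k : Fin K} (hp : 0 < S.p k)
    (hne : ∀ l ∈ S.cluster k, S.hbar k l ≠ 0 ∨ S.R k l ≠ 0) : (S.C k).PosDef := by
  have hpower (i : Fin K) : 0 ≤ (1 - S.ρad) ^ 2 * S.p i := mul_nonneg (sq_nonneg _) (hS.p_nonneg i)
  have hrank (i : Fin K) := Matrix.posSemidef_vecMulVec_self_star (S.gMean k i)
  have hc (i : Fin K) : (Matrix.diagonal fun l : S.cluster k => S.c k i l).PosSemidef :=
    .diagonal fun l => hS.c_nonneg k i l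
  have hothers := Matrix.posSemidef_sum (Finset.univ.erase k) fun i _ =>
    posSemidef_ofReal_smul ((hrank i).add (hc i)) (hpower i)
  have hown := (posSemidef_ofReal_smul (hrank k) (mul_nonneg hS.ρda_nonneg (hpower k))).add
    (posSemidef_ofReal_smul (hc k) (hpower k))
  have hd : (Matrix.diagonal fun l : S.cluster k => S.d k l).PosDef :=
    .diagonal fun l => hS.d_pos hp (hne l l.2)
  convert Matrix.PosDef.posSemidef_add (hown.add hothers) hd using 1
  rw [hS.C_eq, ← Finset.add_sum_erase _ _ (Finset.mem_univ k), gOuter, pdd]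
  push_cast
  simp only [gOuter]
  module

end Valid

end Params

/-! ### Channels and channel estimates as Gaussian vectors -/

instance (K L τ : ℕ) : Finite (Label K L τ) :=
  .of_surjective (Sum.elim (fun q : Fin K × Fin L => .channel q.1 q.2) <|
      Sum.elim (fun q : Fin L × Fin τ => .pilotNoise q.1 q.2) <|
      Sum.elim .signal <| Sum.elim .dac <| Sum.elim .thermal .adc)
    fun j => by cases j <;> simp

/-- The labels of the quantities that determine the channels and their estimates; the other
quantities belong to the data phase. -/
def channelLabels (K L τ : ℕ) : Set (Label K L τ) :=
  {j | match j with
    | .channel _ _ | .pilotNoise _ _ => True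
    | _ => False}

namespace Sources

variable {K L N τ : ℕ} {Ω : Type*} (X : Sources K L N τ Ω) (S : Params K L N τ)

/-- The centred Gaussian variables that determine the channels and their estimates. -/
abbrev channelSpan : Submodule ℂ (Ω → ℂ) := entrySpan X.family (channelLabels K L τ)

/-- The NLOS channel `X.hw i l`, with entries in `channelSpan`. -/
def nlos (i : Fin K) (l : Fin L) : Fin N → X.channelSpan :=
  entries X.family (j := .channel i l) trivial

/-- The pilot noise `X.npilot l t`, with entries in `channelSpan`. -/
def pilotNoise (l : Fin L) (t : Fin τ) : Fin N → X.channelSpan :=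
  entries X.family (j := .pilotNoise l t) trivial

/-- The pilot noise after correlation with the pilot of user `k`. -/
def despreadNoise (k : Fin K) (l : Fin L) : Fin N → X.channelSpan :=
  ((1 / Real.sqrt τ : ℝ) : ℂ) •
    ∑ t, conj (dftPilot τ (S.pilot k) t) • X.pilotNoise l t

/-- The centred pilot observation `X.zw S k l`, with entries in `channelSpan`. -/
def observation (k : Fin K) (l : Fin L) : Fin N → X.channelSpan :=
  ∑ i ∈ S.sharing k, (S.pilotGain i : ℂ) • X.nlos i l + X.despreadNoise S k l

/-- The channel `X.h S i l` as a Gaussian vector. -/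
def channelVec (i : Fin K) (l : Fin L) : GaussVec X.channelSpan (Fin N) :=
  ⟨S.hbar i l, X.nlos i l⟩

/-- The channel estimate `X.hhat S k l` as a Gaussian vector. -/
def estimateVec (k : Fin K) (l : Fin L) : GaussVec X.channelSpan (Fin N) :=
  ⟨S.hbar k l, linTransform (S.estimator k l) (X.observation S k l)⟩

variable {X S}

theorem eval_channelVec (i : Fin K) (l : Fin L) (ω : Ω) :
    (X.channelVec S i l).eval ω = X.h S i l ω := rfl

theorem Z_mulVec_star_dftPilot (k : Fin K) (l : Fin L) (ω : Ω) :
    X.Z S l ω *ᵥ star (dftPilot τ (S.pilot k))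
      = ((1 - S.ρad : ℝ) : ℂ) • ∑ i ∈ S.sharing k,
            ((Real.sqrt (S.pdd i) * τ : ℝ) : ℂ) • X.h S i l ω
        + ∑ t, conj (dftPilot τ (S.pilot k) t) • X.npilot l t ω := by
  have horth (i : Fin K) : dftPilot τ (S.pilot i) ⬝ᵥ star (dftPilot τ (S.pilot k))
      = if i ∈ S.sharing k then (τ : ℂ) else 0 :=
    (sum_dftPilot_mul_conj _ _).trans (if_congr Params.mem_sharing.symm rfl rfl)
  rw [Z, Matrix.add_mulVec, Matrix.smul_mulVec, Matrix.sum_mulVec]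
  congr 2
  · simp only [Matrix.smul_mulVec, Matrix.vecMulVec_mulVec, horth, op_smul_eq_smul,
      ite_smul, zero_smul, smul_ite, smul_zero, Finset.sum_ite_mem, Finset.univ_inter, smul_smul,
      Complex.ofReal_mul, Complex.ofReal_natCast]
  · ext n
    simp [Matrix.mulVec, dotProduct, mul_comm]

theorem z_eq (k : Fin K) (l : Fin L) (ω : Ω) :
    X.z S k l ω = ((1 - S.ρad : ℝ) : ℂ) • ∑ i ∈ S.sharing k,
        (Real.sqrt (S.pdd i * τ) : ℂ) • X.h S i l ω
      + fun n => (X.despreadNoise S k l n).1 ω := by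
  have hroot (i : Fin K) :
      1 / Real.sqrt τ * (Real.sqrt (S.pdd i) * τ) = Real.sqrt (S.pdd i * τ) := by
    rw [Real.sqrt_mul' _ τ.cast_nonneg, one_div_mul_eq_div, mul_div_assoc, Real.div_sqrt]
  simp only [z, Z_mulVec_star_dftPilot, smul_add, smul_comm _ ((1 - S.ρad : ℝ) : ℂ),
    Finset.smul_sum (r := ((1 / Real.sqrt τ : ℝ) : ℂ)), smul_smul _ _ (X.h S _ _ _),
    ← Complex.ofReal_mul, hroot]
  congr 1
  ext n
  simp only [one_div, despreadNoise, Finset.sum_apply, Pi.smul_apply, SetLike.val_smul, smul_eq_mul,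
    AddSubmonoidClass.coe_finsetSum, Finset.mul_sum, Complex.ofReal_inv]
  rfl

theorem zw_eq (k : Fin K) (l : Fin L) (ω : Ω) :
    X.zw S k l ω = fun n => (X.observation S k l n).1 ω := by
  rw [zw, z_eq]
  ext n
  simp only [h, observation, Params.pilotGain, smul_add, Finset.sum_add_distrib, Pi.sub_apply,
    Pi.add_apply, Pi.smul_apply, Finset.sum_apply, Submodule.coe_add,
    AddSubmonoidClass.coe_finsetSum, SetLike.val_smul, smul_eq_mul, Complex.ofReal_mul, mul_assoc,
    Finset.mul_sum]
  rw [add_assoc, add_sub_cancel_left]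
  rfl

theorem eval_estimateVec (k : Fin K) (l : Fin L) (ω : Ω) :
    (X.estimateVec S k l).eval ω = X.hhat S k l ω := by
  ext n
  rw [hhat, zw_eq, ← Params.pilotGain, ← Matrix.smul_mulVec, ← Params.estimator]
  simp [GaussVec.eval, estimateVec, linTransform, Matrix.mulVec, dotProduct]

end Sources

namespace Sources

variable {K L N τ : ℕ} {Ω : Type*} [MeasurableSpace Ω] {P : Measure Ω} {X : Sources K L N τ Ω}
  {S : Params K L N τ}

/-- The covariance matrices of the elementary random quantities. -/
def familyCov (X : Sources K L N τ Ω) (S : Params K L N τ) (P : Measure Ω) :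
    (j : Label K L τ) → Matrix (Fin (j.dim N)) (Fin (j.dim N)) ℂ
  | .channel i l => S.R i l
  | .pilotNoise l _ => S.Cn l
  | .signal i => Matrix.of fun _ _ => (S.p i : ℂ)
  | .dac i => Matrix.of fun _ _ => ((S.ρda * S.p i : ℝ) : ℂ)
  | .thermal _ => ((S.σ ^ 2 : ℝ) : ℂ) • (1 : Matrix (Fin N) (Fin N) ℂ)
  | .adc l => ((S.ρad * (1 - S.ρad) : ℝ) : ℂ) • diagPart (expOuter P (X.adcInput S l))

namespace IsModel

variable (hX : X.IsModel S P)
include hX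

theorem isCN_family (j : Label K L τ) : IsCN (X.family j) 0 (X.familyCov S P j) P := by
  cases j with
  | channel i l => exact hX.hw_law i l
  | pilotNoise l t => exact hX.npilot_law l t
  | signal i => exact hX.s_law i
  | dac i => exact hX.nda_law i
  | thermal l => exact hX.nan_law l
  | adc l => exact hX.nad_law l

variable [IsProbabilityMeasure P]

theorem isCircular (s : Set (Label K L τ)) : IsCircular P (entrySpan X.family s) :=
  isCircular_entrySpan hX.indep hX.isCN_family s

theorem crossCov_nlos (i j : Fin K) (l l' : Fin L) :
    crossCov P (X.nlos i l) (X.nlos j l') = if i = j ∧ l = l' then S.R i l else 0 := by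
  split_ifs with h
  · obtain ⟨rfl, rfl⟩ := h
    exact crossCov_entries_self hX.isCN_family _
  · exact crossCov_entries_of_ne hX.indep hX.isCN_family _ _ (by simpa using h)

theorem crossCov_nlos_pilotNoise (i : Fin K) (l l' : Fin L) (t : Fin τ) :
    crossCov P (X.nlos i l) (X.pilotNoise l' t) = 0 :=
  crossCov_entries_of_ne hX.indep hX.isCN_family _ _ (by simp)

theorem crossCov_pilotNoise (l l' : Fin L) (t t' : Fin τ) :
    crossCov P (X.pilotNoise l t) (X.pilotNoise l' t')
      = if l = l' ∧ t = t' then S.Cn l else 0 := by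
  split_ifs with h
  · obtain ⟨rfl, rfl⟩ := h
    exact crossCov_entries_self hX.isCN_family _
  · exact crossCov_entries_of_ne hX.indep hX.isCN_family _ _ (by simpa using h)

theorem crossCov_nlos_despreadNoise (i k : Fin K) (l l' : Fin L) :
    crossCov P (X.nlos i l) (X.despreadNoise S k l') = 0 := by
  have hE := hX.isCircular (channelLabels K L τ)
  simp only [despreadNoise, hE.crossCov_smul_right, hE.crossCov_sum_right,
    hX.crossCov_nlos_pilotNoise, smul_zero, Finset.sum_const_zero]

theorem crossCov_despreadNoise (k : Fin K) (l l' : Fin L) :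
    crossCov P (X.despreadNoise S k l) (X.despreadNoise S k l')
      = if l = l' then S.Cn l else 0 := by
  have hE := hX.isCircular (channelLabels K L τ)
  have hnorm : ((1 / Real.sqrt τ : ℝ) : ℂ) * (((1 / Real.sqrt τ : ℝ) : ℂ)
      * ∑ t, dftPilot τ (S.pilot k) t * conj (dftPilot τ (S.pilot k) t)) = 1 := by
    have hτ : (τ : ℝ) ≠ 0 := Nat.cast_ne_zero.2 (S.pilot k).pos.ne'
    rw [sum_dftPilot_mul_conj, if_pos rfl, ← mul_assoc, ← Complex.ofReal_mul, div_mul_div_comm,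
      Real.mul_self_sqrt τ.cast_nonneg]
    exact_mod_cast div_mul_cancel₀ (1 * 1 : ℝ) hτ
  simp only [despreadNoise, hE.crossCov_smul_left, hE.crossCov_smul_right, hE.crossCov_sum_left,
    hE.crossCov_sum_right, hX.crossCov_pilotNoise, Complex.conj_ofReal]
  split_ifs with h
  · simp only [h, true_and, smul_ite, smul_zero, Finset.sum_ite_eq, Finset.mem_univ, if_true,
      Complex.conj_conj, smul_smul, ← Finset.sum_smul]
    simp only [mul_comm (conj _), hnorm, one_smul]
  · simp only [h, false_and, if_false, smul_zero, Finset.sum_const_zero]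

theorem crossCov_nlos_observation (i k : Fin K) (l l' : Fin L) :
    crossCov P (X.nlos i l) (X.observation S k l')
      = if i ∈ S.sharing k ∧ l = l' then (S.pilotGain i : ℂ) • S.R i l else 0 := by
  have hE := hX.isCircular (channelLabels K L τ)
  simp only [observation, hE.crossCov_add_right, hE.crossCov_sum_right, hE.crossCov_smul_right,
    hX.crossCov_nlos_despreadNoise, hX.crossCov_nlos, Complex.conj_ofReal, add_zero, ite_and,
    smul_ite, smul_zero, Finset.sum_ite_eq]

theorem crossCov_observation (hS : S.Valid) (k : Fin K) (l l' : Fin L) :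
    crossCov P (X.observation S k l) (X.observation S k l') = if l = l' then S.Ψ k l else 0 := by
  have hE := hX.isCircular (channelLabels K L τ)
  have hnoise : crossCov P (X.despreadNoise S k l) (X.observation S k l')
      = if l = l' then S.Cn l else 0 := by
    simp only [observation, hE.crossCov_add_right, hE.crossCov_sum_right, hE.crossCov_smul_right,
      ← conjTranspose_crossCov (y := X.despreadNoise S k l) (x := X.nlos _ _),
      hX.crossCov_nlos_despreadNoise, hX.crossCov_despreadNoise, Matrix.conjTranspose_zero,
      smul_zero, Finset.sum_const_zero, zero_add]
  rw [observation, hE.crossCov_add_left, hnoise, hE.crossCov_sum_left]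
  simp only [hE.crossCov_smul_left, hX.crossCov_nlos_observation]
  split_ifs with h
  · simp only [h, and_true, smul_ite, smul_zero, smul_smul, ← Complex.ofReal_mul,
      hS.pilotGain_mul_self, Finset.sum_ite_mem, Finset.inter_self, Params.Ψ, Finset.smul_sum,
      mul_assoc, mul_comm (τ : ℝ)]
  · simp only [h, and_false, if_false, smul_zero, Finset.sum_const_zero, add_zero]

theorem crossCov_nlos_estimate (i k : Fin K) (l l' : Fin L) :
    crossCov P (X.nlos i l) (X.estimateVec S k l').dev
      = if i ∈ S.sharing k ∧ l = l' then (S.pilotGain i : ℂ) • (S.R i l * (S.estimator k l)ᴴ)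
        else 0 := by
  rw [estimateVec, (hX.isCircular _).crossCov_linTransform_right, hX.crossCov_nlos_observation]
  split_ifs with h
  · rw [h.2, Matrix.smul_mul]
  · rw [Matrix.zero_mul]

theorem crossCov_estimate (hS : S.Valid) (k : Fin K) (l l' : Fin L) :
    crossCov P (X.estimateVec S k l).dev (X.estimateVec S k l').dev
      = if l = l' then S.estCov k l else 0 := by
  have hE := hX.isCircular (channelLabels K L τ)
  rw [estimateVec, estimateVec, hE.crossCov_linTransform_left, hE.crossCov_linTransform_right,
    hX.crossCov_observation hS]
  split_ifs with h
  · rw [← h, ← Matrix.mul_assoc, hS.estimator_mul_Ψ_mul]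
  · rw [Matrix.zero_mul, Matrix.mul_zero]

theorem mean_add_trace_crossCov (hS : S.Valid) (k i : Fin K) (l : S.cluster k) :
    star (X.estimateVec S k l).mean ⬝ᵥ (X.channelVec S i l).mean
        + (crossCov P (X.channelVec S i l).dev (X.estimateVec S k l).dev).trace
      = S.gMean k i l := by
  rw [channelVec, hX.crossCov_nlos_estimate, Params.gMean]
  by_cases hi : i ∈ S.sharing k
  · simp [hi, hS.pilotGain_mul_trace, Params.lamVec, Params.bVec, Params.lam, estimateVec]
  · simp [hi, Params.lamVec, Params.lam, estimateVec]

theorem hasExp_g (hS : S.Valid) (k i : Fin K) (l : S.cluster k) :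
    HasExp P (fun ω => X.g S (X.hhat S) k i ω l) (S.gMean k i l) := by
  have h := GaussVec.hasExp_star_dotProduct (hX.isCircular (channelLabels K L τ))
    (X.estimateVec S k l) (X.channelVec S i l)
  rw [hX.mean_add_trace_crossCov hS] at h
  simp only [eval_estimateVec, eval_channelVec] at h
  exact h

theorem hasExp_g_mul_conj (hS : S.Valid) (k i : Fin K) (l l' : S.cluster k) :
    HasExp P (fun ω => X.g S (X.hhat S) k i ω l * conj (X.g S (X.hhat S) k i ω l'))
      (S.gOuter k i l l') := by
  have h := GaussVec.hasExp_star_dotProduct_mul_conj (hX.isCircular (channelLabels K L τ))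
    (X.estimateVec S k l) (X.channelVec S i l) (X.estimateVec S k l') (X.channelVec S i l')
  simp only [eval_estimateVec, eval_channelVec, hX.mean_add_trace_crossCov hS,
    hX.crossCov_estimate hS] at h
  refine h.congr (fun _ => rfl) ?_
  rw [channelVec, channelVec, hX.crossCov_nlos, Params.gOuter, Matrix.add_apply,
    Matrix.diagonal_apply, Params.c_eq, add_assoc]
  obtain rfl | hl := eq_or_ne l l'
  · simp [Matrix.vecMulVec_apply, estimateVec, add_assoc]
  · have hl' : (l : Fin L) ≠ l' := Subtype.coe_ne_coe.2 hl
    simp [Matrix.vecMulVec_apply, hl, hl', hl'.symm]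

theorem hasExp_conj_hhat_mul_hhat (hS : S.Valid) (k : Fin K) (l : Fin L) (n : Fin N) :
    HasExp P (fun ω => conj (X.hhat S k l ω n) * X.hhat S k l ω n) (S.estPower k l n) := by
  have hcov := congrFun₂ (hX.crossCov_estimate hS k l l) n n
  have h := (hX.isCircular (channelLabels K L τ)).hasExp_noncentred_two
    (S.hbar k l n) (S.hbar k l n) ((X.estimateVec S k l).dev n) ((X.estimateVec S k l).dev n)
  refine h.congr (fun ω => by rw [← eval_estimateVec]; rfl) ?_
  rw [Params.estPower, mul_comm (conj _)]
  simpa [crossCov] using hcov.symm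

theorem hasExp_channel_mul_conj (hS : S.Valid) (i : Fin K) (l : Fin L) (n : Fin N) :
    HasExp P (fun ω => X.h S i l ω n * conj (X.h S i l ω n)) (S.βLOS i l + S.R i l n n) := by
  have hcov := congrFun₂ (hX.crossCov_nlos i i l l) n n
  have h := (hX.isCircular (channelLabels K L τ)).hasExp_noncentred_two
    (S.hbar i l n) (S.hbar i l n) (X.nlos i l n) (X.nlos i l n)
  refine h.congr (fun ω => mul_comm _ _) ?_
  rw [mul_comm (conj _), hS.hbar_mul_conj]
  simpa [crossCov] using hcov.symm

end IsModel

end Sources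

/-! ### The data phase -/

namespace Sources

variable {K L N τ : ℕ} {Ω : Type*} (X : Sources K L N τ Ω) (S : Params K L N τ)

/-- The centred Gaussian variables of the data phase. -/
abbrev dataSpan : Submodule ℂ (Ω → ℂ) := entrySpan X.family (channelLabels K L τ)ᶜ

/-- The data symbols `X.s`, as members of `dataSpan`. -/
def symbol (i : Fin K) : X.dataSpan := entries X.family (j := .signal i) id (0 : Fin 1)

/-- The DAC noise `X.nda`, as members of `dataSpan`. -/
def dac (i : Fin K) : X.dataSpan := entries X.family (j := .dac i) id (0 : Fin 1)

/-- The thermal noise `X.nan l`, with entries in `dataSpan`. -/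
def thermal (l : Fin L) : Fin N → X.dataSpan := entries X.family (j := .thermal l) id

/-- The ADC noise `X.nad l`, with entries in `dataSpan`. -/
def adc (l : Fin L) : Fin N → X.dataSpan := entries X.family (j := .adc l) id

/-- The signals that leave the transmitters of the users. -/
def transmitted : Fin K → X.dataSpan := (Real.sqrt (1 - S.ρda) : ℂ) • X.symbol + X.dac

/-- The part of the effective noise `X.n S l` that does not pass through a channel. -/
def receiverNoise (l : Fin L) : Fin N → X.dataSpan :=
  ((1 - S.ρad : ℝ) : ℂ) • X.thermal l + X.adc l

/-- The coefficients of the channels and of `1` in the ADC input `X.adcInput S l ω n`. -/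
def inputWeight (l : Fin L) (n : Fin N) : Fin K ⊕ Unit → X.dataSpan :=
  Sum.elim (X.transmitted S) fun _ => X.thermal l n

/-- The channel factors that go with `inputWeight`. -/
def inputFactor (l : Fin L) (n : Fin N) : Fin K ⊕ Unit → Ω → ℂ :=
  Sum.elim (fun i ω => X.h S i l ω n) fun _ _ => 1

/-- The coefficients of `g_ki` and of the conjugated channel estimate in the entry `l` of `f_k`. -/
def noiseWeight (l : Fin L) : Fin K ⊕ Fin N → X.dataSpan :=
  Sum.elim (((1 - S.ρad : ℝ) : ℂ) • X.dac) (X.receiverNoise S l)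

/-- The channel factors that go with `noiseWeight`. -/
def noiseFactor (k : Fin K) (l : S.cluster k) : Fin K ⊕ Fin N → Ω → ℂ :=
  Sum.elim (fun i ω => X.g S (X.hhat S) k i ω l) fun n ω => conj (X.hhat S k l ω n)

variable {X S}

theorem adcInput_eq (l : Fin L) (n : Fin N) (ω : Ω) :
    X.adcInput S l ω n = ∑ t, (X.inputWeight S l n t).1 ω * X.inputFactor S l n t ω := by
  simp only [adcInput, Pi.add_apply, Finset.sum_apply, Pi.smul_apply, smul_eq_mul,
    Fintype.sum_sum_type, Finset.univ_unique, Finset.sum_singleton, inputFactor, Sum.elim_inl,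
    Sum.elim_inr, mul_one]
  rfl

theorem f_eq (k : Fin K) (l : S.cluster k) (ω : Ω) :
    X.f S (X.hhat S) k ω l
      = ∑ t, (X.noiseWeight S l t).1 ω * X.noiseFactor S k l t ω := by
  have hdac : ((1 - S.ρad : ℝ) : ℂ) * star (X.hhat S k l ω) ⬝ᵥ ∑ i, X.nda i ω • X.h S i l ω
      = ∑ i, ((1 - S.ρad : ℝ) : ℂ) * X.nda i ω * X.g S (X.hhat S) k i ω l := by
    simp only [dotProduct_sum, dotProduct_smul, Finset.mul_sum, smul_eq_mul, mul_assoc, g]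
  have hreceiver : ((1 - S.ρad : ℝ) : ℂ) * star (X.hhat S k l ω) ⬝ᵥ X.nan l ω
        + star (X.hhat S k l ω) ⬝ᵥ X.nad l ω
      = ∑ n, (((1 - S.ρad : ℝ) : ℂ) * X.nan l ω n + X.nad l ω n) * conj (X.hhat S k l ω n) := by
    simp only [dotProduct, Finset.mul_sum, ← Finset.sum_add_distrib]
    exact Finset.sum_congr rfl fun _ _ => by rw [Pi.star_apply, RCLike.star_def]; ring
  rw [f, n, dotProduct_add, dotProduct_add, dotProduct_smul, dotProduct_smul, smul_eq_mul,
    smul_eq_mul, add_assoc, hdac, hreceiver, Fintype.sum_sum_type]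
  rfl

variable (X S)

theorem measurable_h (i : Fin K) (l : Fin L) (n : Fin N) :
    Measurable[entrySigma X.family (channelLabels K L τ)] fun ω => X.h S i l ω n :=
  (measurable_of_mem_entrySpan (X.nlos i l n)).const_add _

theorem measurable_hhat (k : Fin K) (l : Fin L) (n : Fin N) :
    Measurable[entrySigma X.family (channelLabels K L τ)] fun ω => X.hhat S k l ω n := by
  simp only [← eval_estimateVec]
  exact (measurable_of_mem_entrySpan _).const_add _

theorem measurable_conj_hhat (k : Fin K) (l : Fin L) (n : Fin N) :
    Measurable[entrySigma X.family (channelLabels K L τ)] fun ω => conj (X.hhat S k l ω n) :=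
  continuous_star.measurable.comp (X.measurable_hhat S k l n)

theorem measurable_inputFactor (l : Fin L) (n : Fin N) (t : Fin K ⊕ Unit) :
    Measurable[entrySigma X.family (channelLabels K L τ)] (X.inputFactor S l n t) := by
  rcases t with i | _
  exacts [X.measurable_h S i l n, measurable_const]

theorem measurable_noiseFactor (k : Fin K) (l : S.cluster k) (t : Fin K ⊕ Fin N) :
    Measurable[entrySigma X.family (channelLabels K L τ)] (X.noiseFactor S k l t) := by
  rcases t with i | n
  · have h := Finset.measurable_sum Finset.univ fun n _ =>
      (X.measurable_conj_hhat S k l n).mul (X.measurable_h S i l n)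
    convert h using 1
    ext ω
    simp [noiseFactor, g, dotProduct]
  · exact X.measurable_conj_hhat S k l n

end Sources

namespace Sources

variable {K L N τ : ℕ} {Ω : Type*} [MeasurableSpace Ω] {P : Measure Ω} {X : Sources K L N τ Ω}
  {S : Params K L N τ}

namespace IsModel

variable (hX : X.IsModel S P) [IsProbabilityMeasure P]
include hX

theorem crossCov_symbol : crossCov P X.symbol X.symbol = Matrix.diagonal fun i => (S.p i : ℂ) := by
  ext i j
  obtain rfl | hij := eq_or_ne i j
  · rw [Matrix.diagonal_apply_eq]
    exact congrFun₂ (crossCov_entries_self hX.isCN_family (j := .signal i) _)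
      (0 : Fin 1) (0 : Fin 1)
  · rw [Matrix.diagonal_apply_ne _ hij]
    exact congrFun₂ (crossCov_entries_of_ne hX.indep hX.isCN_family (i := .signal i)
      (j := .signal j) _ _ (by simpa using hij)) (0 : Fin 1) (0 : Fin 1)

theorem crossCov_dac :
    crossCov P X.dac X.dac = Matrix.diagonal fun i => ((S.ρda * S.p i : ℝ) : ℂ) := by
  ext i j
  obtain rfl | hij := eq_or_ne i j
  · rw [Matrix.diagonal_apply_eq]
    exact congrFun₂ (crossCov_entries_self hX.isCN_family (j := .dac i) _) (0 : Fin 1) (0 : Fin 1)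
  · rw [Matrix.diagonal_apply_ne _ hij]
    exact congrFun₂ (crossCov_entries_of_ne hX.indep hX.isCN_family (i := .dac i)
      (j := .dac j) _ _ (by simpa using hij)) (0 : Fin 1) (0 : Fin 1)

theorem crossCov_symbol_dac : crossCov P X.symbol X.dac = 0 := by
  ext i j
  exact congrFun₂ (crossCov_entries_of_ne hX.indep hX.isCN_family (i := .signal i)
    (j := .dac j) _ _ (by simp)) (0 : Fin 1) (0 : Fin 1)

theorem crossCov_symbol_thermal (l : Fin L) : crossCov P X.symbol (X.thermal l) = 0 := by
  ext i n
  exact congrFun₂ (crossCov_entries_of_ne hX.indep hX.isCN_family (i := .signal i)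
    (j := .thermal l) _ _ (by simp)) (0 : Fin 1) n

theorem crossCov_dac_thermal (l : Fin L) : crossCov P X.dac (X.thermal l) = 0 := by
  ext i n
  exact congrFun₂ (crossCov_entries_of_ne hX.indep hX.isCN_family (i := .dac i)
    (j := .thermal l) _ _ (by simp)) (0 : Fin 1) n

theorem crossCov_dac_adc (l : Fin L) : crossCov P X.dac (X.adc l) = 0 := by
  ext i n
  exact congrFun₂ (crossCov_entries_of_ne hX.indep hX.isCN_family (i := .dac i)
    (j := .adc l) _ _ (by simp)) (0 : Fin 1) n

theorem crossCov_thermal_adc (l l' : Fin L) : crossCov P (X.thermal l) (X.adc l') = 0 :=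
  crossCov_entries_of_ne hX.indep hX.isCN_family _ _ (by simp)

theorem crossCov_thermal (l l' : Fin L) : crossCov P (X.thermal l) (X.thermal l')
    = if l = l' then ((S.σ ^ 2 : ℝ) : ℂ) • (1 : Matrix (Fin N) (Fin N) ℂ) else 0 := by
  split_ifs with h
  · subst h
    exact crossCov_entries_self hX.isCN_family _
  · exact crossCov_entries_of_ne hX.indep hX.isCN_family _ _ (by simpa using h)

theorem crossCov_adc (l l' : Fin L) : crossCov P (X.adc l) (X.adc l')
    = if l = l' then ((S.ρad * (1 - S.ρad) : ℝ) : ℂ) • diagPart (expOuter P (X.adcInput S l))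
      else 0 := by
  split_ifs with h
  · subst h
    exact crossCov_entries_self hX.isCN_family _
  · exact crossCov_entries_of_ne hX.indep hX.isCN_family _ _ (by simpa using h)

theorem crossCov_transmitted (hS : S.Valid) :
    crossCov P (X.transmitted S) (X.transmitted S) = Matrix.diagonal fun i => (S.p i : ℂ) := by
  have hE := hX.isCircular (channelLabels K L τ)ᶜ
  have hswap : crossCov P X.dac X.symbol = 0 := by
    rw [← conjTranspose_crossCov, hX.crossCov_symbol_dac, Matrix.conjTranspose_zero]
  have hsqrt : ((Real.sqrt (1 - S.ρda) * Real.sqrt (1 - S.ρda) : ℝ) : ℂ) = 1 - S.ρda := by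
    rw [Real.mul_self_sqrt (sub_nonneg.2 hS.ρda_lt_one.le)]
    push_cast
    rfl
  simp only [transmitted, hE.crossCov_add_left, hE.crossCov_add_right, hE.crossCov_smul_left,
    hE.crossCov_smul_right, hX.crossCov_symbol, hX.crossCov_dac, hX.crossCov_symbol_dac, hswap,
    smul_zero, add_zero, zero_add, Complex.conj_ofReal, smul_smul, ← Complex.ofReal_mul, hsqrt,
    ← Matrix.diagonal_smul, Matrix.diagonal_add]
  congr 1
  ext i
  simp only [Pi.smul_apply, smul_eq_mul, Complex.ofReal_mul]
  ring

theorem crossCov_transmitted_thermal (l : Fin L) :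
    crossCov P (X.transmitted S) (X.thermal l) = 0 := by
  have hE := hX.isCircular (channelLabels K L τ)ᶜ
  rw [transmitted, hE.crossCov_add_left, hE.crossCov_smul_left, hX.crossCov_symbol_thermal,
    hX.crossCov_dac_thermal, smul_zero, add_zero]

theorem crossCov_inputWeight (hS : S.Valid) (l : Fin L) (n : Fin N) :
    crossCov P (X.inputWeight S l n) (X.inputWeight S l n)
      = Matrix.diagonal (Sum.elim (fun i => (S.p i : ℂ)) fun _ => (S.σ : ℂ) ^ 2) := by
  have hcross : crossCov P (X.transmitted S) (fun _ : Unit => X.thermal l n) = 0 := by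
    ext i _
    exact congrFun₂ (hX.crossCov_transmitted_thermal l) i n
  have hthermal : crossCov P (fun _ : Unit => X.thermal l n) (fun _ : Unit => X.thermal l n)
      = Matrix.diagonal fun _ => (S.σ : ℂ) ^ 2 := by
    ext
    rw [Matrix.diagonal_apply_eq]
    exact (congrFun₂ (hX.crossCov_thermal l l) n n).trans (by simp)
  rw [inputWeight, crossCov_sumElim, hX.crossCov_transmitted hS, hthermal,
    ← conjTranspose_crossCov (y := fun _ : Unit => X.thermal l n), hcross,
    Matrix.conjTranspose_zero, Matrix.fromBlocks_diagonal]

omit [IsProbabilityMeasure P] in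
theorem measurable_of_channel {α : Type*} [MeasurableSpace α] {x : Ω → α}
    (hx : Measurable[entrySigma X.family (channelLabels K L τ)] x) : Measurable x :=
  hx.mono (entrySigma_le (fun j => (hX.isCN_family j).1) _) le_rfl

theorem memLp_inputFactor (hS : S.Valid) (l : Fin L) (n : Fin N) (t : Fin K ⊕ Unit) :
    MemLp (X.inputFactor S l n t) 2 P := by
  rcases t with i | _
  · exact (hX.hasExp_channel_mul_conj hS i l n).memLp_two
      (hX.measurable_of_channel (X.measurable_h S i l n))
  · exact memLp_const 1

theorem hasExp_adcInput_mul_conj (hS : S.Valid) (l : Fin L) (n : Fin N) :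
    HasExp P (fun ω => X.adcInput S l ω n * conj (X.adcInput S l ω n)) (S.adcPower l n) := by
  have h := hasExp_sum_mul_conj_sum hX.indep hX.isCN_family (hX.crossCov_inputWeight hS l n)
    (X.measurable_inputFactor S l n) (X.measurable_inputFactor S l n)
    (hX.memLp_inputFactor hS l n) (hX.memLp_inputFactor hS l n)
  refine h.congr (fun ω => by rw [adcInput_eq]) ?_
  simp [inputFactor, (hX.hasExp_channel_mul_conj hS _ l n).2, Params.adcPower]

theorem diagPart_expOuter_adcInput (hS : S.Valid) (l : Fin L) :
    diagPart (expOuter P (X.adcInput S l)) = Matrix.diagonal (S.adcPower l) := by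
  rw [diagPart]
  exact congrArg _ (funext fun n => (hX.hasExp_adcInput_mul_conj hS l n).2)

theorem crossCov_receiverNoise (hS : S.Valid) (l l' : Fin L) :
    crossCov P (X.receiverNoise S l) (X.receiverNoise S l')
      = if l = l' then Matrix.diagonal (S.noiseVar l) else 0 := by
  have hE := hX.isCircular (channelLabels K L τ)ᶜ
  have hswap : crossCov P (X.adc l) (X.thermal l') = 0 := by
    rw [← conjTranspose_crossCov, hX.crossCov_thermal_adc, Matrix.conjTranspose_zero]
  simp only [receiverNoise, hE.crossCov_add_left, hE.crossCov_add_right, hE.crossCov_smul_left,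
    hE.crossCov_smul_right, hX.crossCov_thermal, hX.crossCov_adc, hX.crossCov_thermal_adc, hswap,
    hX.diagPart_expOuter_adcInput hS, smul_zero, add_zero, zero_add]
  split_ifs with h
  · ext m n
    obtain rfl | hmn := eq_or_ne m n
    · simp only [Complex.ofReal_sub, Complex.ofReal_one, map_sub, map_one, Complex.conj_ofReal,
        Complex.ofReal_pow, Complex.ofReal_mul, Matrix.add_apply, Matrix.smul_apply,
        Matrix.one_apply_eq, smul_eq_mul, mul_one, Matrix.diagonal_apply_eq, Params.noiseVar,
        add_left_inj]
      ring
    · simp [hmn]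
  · simp

theorem crossCov_dac_receiverNoise (l : Fin L) : crossCov P X.dac (X.receiverNoise S l) = 0 := by
  have hE := hX.isCircular (channelLabels K L τ)ᶜ
  rw [receiverNoise, hE.crossCov_add_right, hE.crossCov_smul_right, hX.crossCov_dac_thermal,
    hX.crossCov_dac_adc, smul_zero, add_zero]

theorem crossCov_noiseWeight (hS : S.Valid) (l l' : Fin L) :
    crossCov P (X.noiseWeight S l) (X.noiseWeight S l')
      = Matrix.diagonal (Sum.elim
          (fun i => (((1 - S.ρad) ^ 2 * S.ρda * S.p i : ℝ) : ℂ))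
          fun n => if l = l' then S.noiseVar l n else 0) := by
  have hE := hX.isCircular (channelLabels K L τ)ᶜ
  have hcross (m : Fin L) :
      crossCov P (((1 - S.ρad : ℝ) : ℂ) • X.dac) (X.receiverNoise S m) = 0 := by
    rw [hE.crossCov_smul_left, hX.crossCov_dac_receiverNoise, smul_zero]
  have hdac : crossCov P (((1 - S.ρad : ℝ) : ℂ) • X.dac) (((1 - S.ρad : ℝ) : ℂ) • X.dac)
      = Matrix.diagonal fun i => (((1 - S.ρad) ^ 2 * S.ρda * S.p i : ℝ) : ℂ) := by
    rw [hE.crossCov_smul_left, hE.crossCov_smul_right, hX.crossCov_dac, Complex.conj_ofReal,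
      smul_smul, ← Matrix.diagonal_smul]
    congr 1
    ext i
    simp only [Pi.smul_apply, smul_eq_mul, ← Complex.ofReal_mul]
    ring_nf
  have hreceiver : crossCov P (X.receiverNoise S l) (X.receiverNoise S l')
      = Matrix.diagonal fun n => if l = l' then S.noiseVar l n else 0 := by
    rw [hX.crossCov_receiverNoise hS]
    split_ifs
    exacts [rfl, Matrix.diagonal_zero.symm]
  rw [noiseWeight, noiseWeight, crossCov_sumElim, hdac, hreceiver, hcross,
    ← conjTranspose_crossCov (y := X.receiverNoise S l), hcross, Matrix.conjTranspose_zero,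
    Matrix.fromBlocks_diagonal]

theorem memLp_noiseFactor (hS : S.Valid) (k : Fin K) (l : S.cluster k) (t : Fin K ⊕ Fin N) :
    MemLp (X.noiseFactor S k l t) 2 P := by
  have hm := hX.measurable_of_channel (X.measurable_noiseFactor S k l t)
  rcases t with i | n
  · exact (hX.hasExp_g_mul_conj hS k i l l).memLp_two hm
  · exact ((hX.hasExp_conj_hhat_mul_hhat hS k l n).congr
      (fun ω => by rw [noiseFactor, Sum.elim_inr, Complex.conj_conj]) rfl).memLp_two hm

theorem hasExp_f_mul_conj (hS : S.Valid) (k : Fin K) (l l' : S.cluster k) :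
    HasExp P (fun ω => X.f S (X.hhat S) k ω l * conj (X.f S (X.hhat S) k ω l'))
      (∑ i, (((1 - S.ρad) ^ 2 * S.ρda * S.p i : ℝ) : ℂ) * S.gOuter k i l l'
        + Matrix.diagonal (fun l : S.cluster k => S.d k l) l l') := by
  have h := hasExp_sum_mul_conj_sum hX.indep hX.isCN_family (hX.crossCov_noiseWeight hS l l')
    (X.measurable_noiseFactor S k l) (X.measurable_noiseFactor S k l')
    (hX.memLp_noiseFactor hS k l) (hX.memLp_noiseFactor hS k l')
  refine h.congr (fun ω => by rw [f_eq, f_eq]) ?_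
  rw [Fintype.sum_sum_type]
  congr 1
  · exact Finset.sum_congr rfl fun i _ =>
      congrArg _ (hX.hasExp_g_mul_conj hS k i l l').2.symm
  · obtain rfl | hl := eq_or_ne l l'
    · simp [noiseFactor, (hX.hasExp_conj_hhat_mul_hhat hS k l _).2, hS.d_eq]
    · simp [Matrix.diagonal_apply_ne _ hl, Subtype.coe_ne_coe.2 hl]

end IsModel

end Sources

/-! ### The spectral efficiency -/

theorem star_dotProduct_expOuter_mulVec {Ω ι : Type*} [MeasurableSpace Ω] [Fintype ι]
    {P : Measure Ω} {x : Ω → ι → ℂ} (hx : ∀ a b, Integrable (fun ω => x ω a * conj (x ω b)) P)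
    (a : ι → ℂ) :
    star a ⬝ᵥ expOuter P x *ᵥ a = ((∫ ω, ‖star a ⬝ᵥ x ω‖ ^ 2 ∂P : ℝ) : ℂ) := by
  have hterm (i j : ι) : HasExp P (fun ω => conj (a i) * a j * (x ω i * conj (x ω j)))
      (conj (a i) * a j * expOuter P x i j) :=
    HasExp.const_mul _ ⟨hx i j, rfl⟩
  have h : HasExp P (fun ω => ((‖star a ⬝ᵥ x ω‖ ^ 2 : ℝ) : ℂ)) (star a ⬝ᵥ expOuter P x *ᵥ a) := by
    refine (HasExp.sum (s := Finset.univ) fun i _ => HasExp.sum (s := Finset.univ) fun j _ =>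
      hterm i j).congr (fun ω => ?_) ?_
    · rw [Complex.ofReal_pow, ← Complex.mul_conj']
      simp only [dotProduct, map_sum, Finset.sum_mul_sum, map_mul, Pi.star_apply,
        RCLike.star_def, Complex.conj_conj]
      exact Finset.sum_congr rfl fun i _ => Finset.sum_congr rfl fun j _ => by ring
    · simp only [dotProduct, Matrix.mulVec, Finset.mul_sum, Pi.star_apply, RCLike.star_def]
      exact Finset.sum_congr rfl fun i _ => Finset.sum_congr rfl fun j _ => by ring
  exact h.2.symm.trans integral_ofReal

namespace Sources.IsModel

variable {K L N τ τc : ℕ} {Ω : Type*} [MeasurableSpace Ω] {P : Measure Ω} {X : Sources K L N τ Ω}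
  {S : Params K L N τ} (hX : X.IsModel S P) [IsProbabilityMeasure P] (hS : S.Valid)
include hX hS

theorem expVec_g (k i : Fin K) : expVec P (X.g S (X.hhat S) k i) = S.gMean k i :=
  funext fun l => (hX.hasExp_g hS k i l).2

theorem expOuter_g (k i : Fin K) : expOuter P (X.g S (X.hhat S) k i) = S.gOuter k i :=
  Matrix.ext fun l l' => (hX.hasExp_g_mul_conj hS k i l l').2

theorem expOuter_f (k : Fin K) : expOuter P (X.f S (X.hhat S) k)
    = ∑ i, (((1 - S.ρad) ^ 2 * S.ρda * S.p i : ℝ) : ℂ) • S.gOuter k i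
      + Matrix.diagonal fun l : S.cluster k => S.d k l := by
  ext l l'
  rw [Matrix.add_apply, Matrix.sum_apply]
  exact (hX.hasExp_f_mul_conj hS k l l').2

theorem B_eq_C (k : Fin K) : X.B S P (X.hhat S) k = S.C k := by
  -- The DAC distortion is received through the channels, like the data, and restores the power
  -- `p i` from the share `(1 - ρda) * p i` of the data.
  have hpower (i : Fin K) : (((1 - S.ρad) ^ 2 : ℝ) : ℂ) * S.pdd i
      + (((1 - S.ρad) ^ 2 * S.ρda * S.p i : ℝ) : ℂ) = (((1 - S.ρad) ^ 2 * S.p i : ℝ) : ℂ) := by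
    rw [Params.pdd]
    push_cast
    ring
  simp only [B, hX.expVec_g hS, hX.expOuter_g hS, hX.expOuter_f hS, hS.C_eq, Finset.smul_sum,
    smul_smul, ← hpower, add_smul, Finset.sum_add_distrib]
  abel

theorem SINR_eq (k : Fin K) (a : S.cluster k → ℂ) :
    X.SINR S P (X.hhat S) k a = (1 - S.ρad) ^ 2 * S.pdd k
      * rayleighQuotient (X.B S P (X.hhat S) k) (expVec P (X.g S (X.hhat S) k k)) a := by
  have hg (i : Fin K) := star_dotProduct_expOuter_mulVec
    (fun l l' => (hX.hasExp_g_mul_conj hS k i l l').1) a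
  rw [SINR, rayleighQuotient, mul_div_assoc, B]
  congr 2
  simp only [Matrix.sub_mulVec, Matrix.add_mulVec, Matrix.smul_mulVec, Matrix.sum_mulVec,
    dotProduct_sub, dotProduct_add, dotProduct_smul, dotProduct_sum, smul_eq_mul, hg,
    star_dotProduct_vecMulVec_mulVec, RCLike.re_eq_complex_re, Complex.sub_re, Complex.add_re,
    Complex.re_ofReal_mul, Complex.re_sum, Complex.ofReal_re, Complex.coe_algebraMap]
  ring

theorem SEmax_eq_closedFormSE (k : Fin K) :
    X.SEmax S P τc (X.hhat S) k = S.closedFormSE τc k := by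
  rw [SEmax, Params.closedFormSE, hX.B_eq_C hS, hX.expVec_g hS, Params.gMean_self]

theorem SE_aopt {k : Fin K} (hB : (X.B S P (X.hhat S) k).PosDef) :
    X.SE S P τc (X.hhat S) k (X.aopt S P (X.hhat S) k) = X.SEmax S P τc (X.hhat S) k := by
  rw [SE, SEmax, hX.SINR_eq hS, aopt, rayleighQuotient_inv_mulVec hB, RCLike.re_eq_complex_re]

theorem SE_le_SEmax (hτ : τ ≤ τc) {k : Fin K} (hB : (X.B S P (X.hhat S) k).PosDef)
    (a : S.cluster k → ℂ) : X.SE S P τc (X.hhat S) k a ≤ X.SEmax S P τc (X.hhat S) k := by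
  have hpower : 0 ≤ (1 - S.ρad) ^ 2 * S.pdd k := mul_nonneg (sq_nonneg _) (hS.pdd_nonneg k)
  have hquot := rayleighQuotient_le hB (expVec P (X.g S (X.hhat S) k k)) a
  have hquot_nonneg : 0 ≤ rayleighQuotient (X.B S P (X.hhat S) k)
      (expVec P (X.g S (X.hhat S) k k)) a :=
    div_nonneg (sq_nonneg _) (hB.posSemidef.re_dotProduct_nonneg a)
  rw [SE, SEmax, hX.SINR_eq hS]
  refine mul_le_mul_of_nonneg_left (Real.logb_le_logb_of_le one_lt_two (by positivity) ?_)
    (sub_nonneg.2 (div_le_one_of_le₀ (Nat.cast_le.2 hτ) τc.cast_nonneg))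
  exact add_le_add_right (mul_le_mul_of_nonneg_left hquot hpower) 1

end Sources.IsModel

end CellFree

end

theorem theorem2 {K L N τ τc : ℕ} (S : CellFree.Params K L N τ) (hS : S.Valid)
    (hτ : τ ≤ τc)
    {Ω : Type*} [MeasurableSpace Ω] (P : Measure Ω) [IsProbabilityMeasure P]
    (X : CellFree.Sources K L N τ Ω) (hX : X.IsModel S P)
    (k : Fin K) (hp : 0 < S.p k) (hM : (S.cluster k).Nonempty)
    (hne : ∀ l ∈ S.cluster k, S.hbar k l ≠ 0 ∨ S.R k l ≠ 0) :
    -- all expectations that enter the spectral efficiency under MRC exist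
    ((∀ i l, Integrable (fun ω => X.g S (X.hhat S) k i ω l) P) ∧
      (∀ i l₁ l₂, Integrable (fun ω =>
        X.g S (X.hhat S) k i ω l₁ * conj (X.g S (X.hhat S) k i ω l₂)) P) ∧
      (∀ l₁ l₂, Integrable (fun ω =>
        X.f S (X.hhat S) k ω l₁ * conj (X.f S (X.hhat S) k ω l₂)) P)) ∧
    -- the matrices that are inverted are positive definite
    (X.B S P (X.hhat S) k).PosDef ∧ (S.C k).PosDef ∧
    -- the closed form is the maximum over all LSFD vectors
    IsGreatest ((fun a => X.SE S P τc (X.hhat S) k a) '' {a | a ≠ 0}) (S.closedFormSE τc k) ∧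
    -- it is attained at the optimal LSFD vector
    X.aopt S P (X.hhat S) k ≠ 0 ∧
    X.SE S P τc (X.hhat S) k (X.aopt S P (X.hhat S) k) = S.closedFormSE τc k ∧
    X.SEmax S P τc (X.hhat S) k = S.closedFormSE τc k := by
  have hC := hS.posDef_C hp hne
  have hB : (X.B S P (X.hhat S) k).PosDef := hX.B_eq_C hS k ▸ hC
  have hu : CellFree.expVec P (X.g S (X.hhat S) k k) ≠ 0 :=
    hX.expVec_g hS k k ▸ hS.gMean_self_ne_zero hp hM hne
  have haopt : X.aopt S P (X.hhat S) k ≠ 0 := CellFree.inv_mulVec_ne_zero hB hu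
  have hmax : X.SEmax S P τc (X.hhat S) k = S.closedFormSE τc k := hX.SEmax_eq_closedFormSE hS k
  have hattained := (hX.SE_aopt (τc := τc) hS hB).trans hmax
  refine ⟨⟨fun i l => (hX.hasExp_g hS k i l).1,
    fun i l₁ l₂ => (hX.hasExp_g_mul_conj hS k i l₁ l₂).1,
    fun l₁ l₂ => (hX.hasExp_f_mul_conj hS k l₁ l₂).1⟩, hB, hC,
    ⟨⟨_, haopt, hattained⟩, ?_⟩, haopt, hattained, hmax⟩
  rintro _ ⟨a, -, rfl⟩
  exact hmax ▸ hX.SE_le_SEmax hS hτ hB a
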